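/- Let $n\ge 1$. For $1\le i,j\le n$ let $a_{ij}:\mathbb R^n\times\mathbb R\to\mathbb R$, and let $f:\mathbb R^n\times\mathbb R\times\mathbb R^n\to\mathbb R$; no regularity, not even measurability, is required of $a_{ij}$ and $f$. Assume that $$\sum_{i,j=1}^n a_{ij}(x,\zeta)\,\xi_i\xi_j>0\qquad\text{for all }x\in\mathbb R^n,\ \zeta\in\mathbb R\setminus\{0\},\ \xi\in\mathbb R^n\setminus\{0\}.$$ Let $g,h:(0,\infty)\to(0,\infty)$ and $p:\mathbb R^n\to[0,\infty)$ be locally bounded measurable functions such that $\inf_K g>0$ and $\inf_K h>0$ for every nonempty compact set $K\subset(0,\infty)$, and suppose that $$f(x,\zeta,\lambda x)\,\operatorname{sign}\zeta\ \ge\ p(x)\,g(|\zeta|)\Bigl(1+\sum_{i,j=1}^n|a_{ij}(x,\zeta)|\Bigr)$$ for all $x\in\mathbb R^n$, all $\zeta\in\mathbb R\setminus\{0\}$ and all $\lambda\in\mathbb R$ with $0\le\lambda\operatorname{sign}\zeta\le p(x)\,h(|\zeta|)$. For $r>0$ put $q(r)=\inf\{p(y):|y|<r\}$, and for $\varphi:(0,\infty)\to\mathbb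 R$, $\theta>1$ and $\zeta>0$ put $\varphi_\theta(\zeta)=\inf_{(\zeta/\theta,\,\theta\zeta)}\varphi$. Suppose that $$\int_1^\infty r\,q(r)\,dr=\infty$$ and that, for some real number $\theta>1$, $$\int_1^\infty\bigl(g_\theta(\zeta)\,\zeta\bigr)^{-1/2}\,d\zeta<\infty\qquad\text{and}\qquad\int_1^\infty\frac{d\zeta}{h_\theta(\zeta)}<\infty.$$ Let $u$ be a classical solution of $$u_t-\sum_{i,j=1}^n a_{ij}(x,u)\,u_{x_ix_j}+f(x,u,Du)=0\quad\text{in }\mathbb R^n\times(0,\infty),$$ that is, $u$ is continuous with continuous derivatives $u_t$, $u_{x_i}$, $u_{x_ix_j}$ in $\mathbb R^n\times(0,\infty)$ and satisfies the equation at every point; $Du$ denotes the gradient in $x$. Then for every compact set $K\subset\mathbb R^n$, $$\lim_{t\to\infty}\ \sup_{x\in K}|u(x,t)|=0.$$ -/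

import Mathlib

open MeasureTheory Filter Topology Set

noncomputable section

/-- The Euclidean space of dimension `n`. -/
abbrev Rn (n : ℕ) : Type := EuclideanSpace ℝ (Fin n)

/-- The open half-space of points `(x, t)` with `t > 0`. -/
def halfSpace (n : ℕ) : Set (Rn n × ℝ) := univ ×ˢ Ioi (0 : ℝ)

/-- The partial derivative of `v` with respect to the `i`-th coordinate. -/
def pderivX {n : ℕ} (i : Fin n) (v : Rn n → ℝ) (x : Rn n) : ℝ :=
  fderiv ℝ v x (EuclideanSpace.single i 1)

/-- Functions `u(x, t)` on the half-space `t > 0` with two continuous derivatives in `x` and one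
continuous derivative in `t` (continuity is joint in `(x, t)`). Only the values of `u` at
`t > 0` matter. -/
structure IsC21 {n : ℕ} (u : Rn n → ℝ → ℝ) : Prop where
  contDiff_x : ∀ t : ℝ, 0 < t → ContDiff ℝ 2 (fun x => u x t)
  differentiable_t : ∀ (x : Rn n) (t : ℝ), 0 < t → DifferentiableAt ℝ (u x) t
  continuousOn : ContinuousOn (fun z : Rn n × ℝ => u z.1 z.2) (halfSpace n)
  continuousOn_x : ∀ i : Fin n,
    ContinuousOn (fun z : Rn n × ℝ => pderivX i (fun y => u y z.2) z.1) (halfSpace n)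
  continuousOn_xx : ∀ i j : Fin n,
    ContinuousOn (fun z : Rn n × ℝ => pderivX i (pderivX j (fun y => u y z.2)) z.1) (halfSpace n)
  continuousOn_t : ContinuousOn (fun z : Rn n × ℝ => deriv (u z.1) z.2) (halfSpace n)

/-- Classical solutions in the half-space `t > 0` of
`u_t - ∑ a_ij(x, u) u_{x_i x_j} + f(x, u, Du) = 0`. -/
structure IsClassicalSolution {n : ℕ} (a : Rn n → ℝ → Matrix (Fin n) (Fin n) ℝ)
    (f : Rn n → ℝ → Rn n → ℝ) (u : Rn n → ℝ → ℝ) : Prop where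
  regular : IsC21 u
  equation : ∀ (x : Rn n) (t : ℝ), 0 < t →
    deriv (u x) t
      - ∑ i, ∑ j, a x (u x t) i j * pderivX i (pderivX j (fun y => u y t)) x
      + f x (u x t) (gradient (fun y => u y t) x) = 0

/-- `φ : (0, ∞) → (0, ∞)` (extended arbitrarily to `ℝ`) is Lebesgue measurable, bounded on every
compact subset of `(0, ∞)`, and has a positive infimum on every such subset. -/
structure IsPositiveWeight (φ : ℝ → ℝ) : Prop where
  pos : ∀ ζ : ℝ, 0 < ζ → 0 < φ ζ
  measurable : AEMeasurable φ (volume.restrict (Ioi (0 : ℝ)))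
  bounded : ∀ K : Set ℝ, IsCompact K → K ⊆ Ioi 0 → ∃ C : ℝ, ∀ ζ ∈ K, φ ζ ≤ C
  inf_pos : ∀ K : Set ℝ, IsCompact K → K ⊆ Ioi 0 → ∃ c : ℝ, 0 < c ∧ ∀ ζ ∈ K, c ≤ φ ζ

/-- `p : ℝⁿ → [0, ∞)` is Lebesgue measurable and locally bounded. -/
structure IsNonnegWeight {n : ℕ} (p : Rn n → ℝ) : Prop where
  nonneg : ∀ x, 0 ≤ p x
  measurable : AEMeasurable p volume
  bounded : ∀ K : Set (Rn n), IsCompact K → ∃ C : ℝ, ∀ x ∈ K, p x ≤ C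

/-- `∑ a_ij(x, ζ) ξ_i ξ_j > 0` for all `x`, all `ζ ≠ 0` and all `ξ ≠ 0`
(no symmetry of the matrix is required). -/
def IsPositiveAwayFromZero {n : ℕ} (a : Rn n → ℝ → Matrix (Fin n) (Fin n) ℝ) : Prop :=
  ∀ (x : Rn n) (ζ : ℝ) (ξ : Rn n), ζ ≠ 0 → ξ ≠ 0 → 0 < ∑ i, ∑ j, a x ζ i j * ξ i * ξ j

/-- The lower bound on `f(x, ζ, λ x) sign ζ` for `0 ≤ λ sign ζ ≤ p(x) h(|ζ|)`. -/
def StructuralBound {n : ℕ} (a : Rn n → ℝ → Matrix (Fin n) (Fin n) ℝ)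
    (f : Rn n → ℝ → Rn n → ℝ) (p : Rn n → ℝ) (g h : ℝ → ℝ) : Prop :=
  ∀ (x : Rn n) (ζ lam : ℝ), ζ ≠ 0 →
    0 ≤ lam * Real.sign ζ → lam * Real.sign ζ ≤ p x * h |ζ| →
    p x * g |ζ| * (1 + ∑ i, ∑ j, |a x ζ i j|) ≤ f x ζ (lam • x) * Real.sign ζ

/-- `q(r)`, the infimum of `p` over the open ball of radius `r` centred at the origin. -/
def ballInf {n : ℕ} (p : Rn n → ℝ) (r : ℝ) : ℝ := sInf (p '' Metric.ball 0 r)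

/-- `φ_θ(ζ)`, the infimum of `φ` over the interval `(ζ / θ, θ ζ)`. -/
def infNear (θ : ℝ) (φ : ℝ → ℝ) (ζ : ℝ) : ℝ := sInf (φ '' Ioo (ζ / θ) (θ * ζ))

end

/-! Fix ε > 0 and consider F = Γ(1/(u - ε)) + Φ(x) - c(t - t₀) where u > ε. Here Γ > 0 is concave
and increasing on (0, ∞), and Φ ≥ 0 is radial, concave in |x|² and tends to infinity. The set F = 0
is the graph of a barrier that is infinite at t = t₀, so comparison needs no bound on u at that
time. `barrier_pos` shows F > 0 for a time D/c independent of u and t₀; at its end u ≤ 2ε on K.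
Applying this to u and -u gives the limit.

If F > 0 failed, there would be a first contact point. Concavity replaces Γ and Φ by their
supporting lines there, so u is touched from above by explicit functions; Γ and Φ need slopes but no
derivatives. The touching function is radial, hence Du = λx, the only gradients for which f is
controlled. `not_contact` shows that f then exceeds the second-order and time terms, contradicting
the equation.

The integral conditions provide the barriers. `exists_space_barrier` uses the divergence of ∫ r q to
get an unbounded Φ with slopes below p. `exists_value_barrier` uses the two convergent integrals to
get slopes N of Γ that dominate the required powers of u and are still integrable at 0. -/

/-! ### Derivative tests and nonnegative forms. -/

theorem IsLocalMax.second_deriv_nonpos {φ φ' : ℝ → ℝ} {x d : ℝ} (hmax : IsLocalMax φ x)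
    (h1 : ∀ᶠ y in 𝓝 x, HasDerivAt φ (φ' y) y) (h2 : HasDerivAt φ' d x) : d ≤ 0 := by
  by_contra! hd
  have e1 : deriv φ =ᶠ[𝓝 x] φ' := h1.mono fun y hy => hy.deriv
  have e2 : deriv (deriv φ) x = d := by rw [e1.deriv_eq, h2.deriv]
  -- With d > 0 the point is a minimum as well as a maximum, so φ is locally constant and d = 0.
  have hmin : IsLocalMin φ x := isLocalMin_of_deriv_deriv_pos (by rw [e2]; exact hd)
    hmax.deriv_eq_zero h1.self_of_nhds.continuousAt
  have e3 : φ =ᶠ[𝓝 x] fun _ => φ x := by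
    filter_upwards [hmax, hmin] with y hy hy' using le_antisymm hy hy'
  have e4 : deriv φ =ᶠ[𝓝 x] fun _ => 0 := by
    have := e3.deriv
    simpa using this
  have e5 := e4.deriv_eq
  simp only [deriv_const] at e5
  linarith

theorem deriv_nonneg_of_left_le {φ : ℝ → ℝ} {x d : ℝ} (h : HasDerivAt φ d x)
    (hle : ∀ᶠ y in 𝓝[<] x, φ y ≤ φ x) : 0 ≤ d := by
  have h1 : Tendsto (slope φ x) (𝓝[<] x) (𝓝 d) :=
    (hasDerivAt_iff_tendsto_slope.1 h).mono_left
      (nhdsWithin_mono _ fun y hy => ne_of_lt hy)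
  refine ge_of_tendsto h1 ?_
  filter_upwards [hle, self_mem_nhdsWithin] with y hy hy'
  rw [slope_def_field]
  exact div_nonneg_of_nonpos (by linarith) (by have : y < x := hy'; linarith)

/-- Decomposing M into rank-one terms B_k B_kᵀ turns the sum into values of the form of A. Only M
has to be symmetric. -/
theorem sum_mul_nonneg_of_form_nonneg {ι : Type*} [Fintype ι] [DecidableEq ι] {A M : Matrix ι ι ℝ}
    (hA : ∀ ξ : ι → ℝ, 0 ≤ ∑ i, ∑ j, A i j * ξ i * ξ j) (hsymm : ∀ i j, M i j = M j i)
    (hM : ∀ ξ : ι → ℝ, 0 ≤ ∑ i, ∑ j, M i j * ξ i * ξ j) : 0 ≤ ∑ i, ∑ j, A i j * M i j := by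
  have hps : M.PosSemidef := by
    refine Matrix.PosSemidef.of_dotProduct_mulVec_nonneg ?_ fun ξ => ?_
    · ext i j
      simp [hsymm i j]
    · refine (hM ξ).trans_eq ?_
      simp only [dotProduct, Matrix.mulVec, Finset.mul_sum, star_trivial]
      exact Finset.sum_congr rfl fun i _ => Finset.sum_congr rfl fun j _ => by ring
  obtain ⟨m, B, hB⟩ := Matrix.posSemidef_iff_eq_sum_vecMulVec.mp hps
  have hMB : ∀ i j, M i j = ∑ k, B k i * B k j := fun i j => by
    rw [hB, Matrix.sum_apply]
    simp [Matrix.vecMulVec_apply]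
  have : ∑ i, ∑ j, A i j * M i j = ∑ k, ∑ i, ∑ j, A i j * B k i * B k j := by
    simp only [hMB, Finset.mul_sum, ← mul_assoc]
    rw [Finset.sum_congr rfl fun i _ => Finset.sum_comm]
    exact Finset.sum_comm
  rw [this]
  exact Finset.sum_nonneg fun k _ => hA (B k)

/-! ### Gradient and Hessian at a contact point. -/

theorem clm_apply_eq_sum {n : ℕ} (L : Rn n →L[ℝ] ℝ) (ξ : Rn n) :
    L ξ = ∑ j, ξ j * L (EuclideanSpace.single j 1) := by
  conv_lhs => rw [← (EuclideanSpace.basisFun (Fin n) ℝ).sum_repr ξ]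
  simp

theorem differentiable_pderivX {n : ℕ} {U : Rn n → ℝ} (hU : ContDiff ℝ 2 U) (j : Fin n) :
    Differentiable ℝ (pderivX j U) := by
  have : ContDiff ℝ 1 (fderiv ℝ U) := hU.fderiv_right (by norm_num)
  exact (this.clm_apply contDiff_const).differentiable (by norm_num)

theorem pderivX_comm {n : ℕ} {U : Rn n → ℝ} (hU : ContDiff ℝ 2 U) (i j : Fin n) (x : Rn n) :
    pderivX i (pderivX j U) x = pderivX j (pderivX i U) x := by
  have h1 : Differentiable ℝ (fderiv ℝ U) :=
    (hU.fderiv_right (m := 1) (by norm_num)).differentiable (by norm_num)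
  have key : ∀ i j : Fin n, pderivX i (pderivX j U) x
      = fderiv ℝ (fderiv ℝ U) x (EuclideanSpace.single i 1) (EuclideanSpace.single j 1) := by
    intro i j
    have : HasFDerivAt (pderivX j U) _ x :=
      (h1 x).hasFDerivAt.clm_apply (hasFDerivAt_const (EuclideanSpace.single j (1 : ℝ)) x)
    rw [pderivX, this.fderiv]
    simp
  rw [key, key]
  have hs : IsSymmSndFDerivAt ℝ U x := hU.contDiffAt.isSymmSndFDerivAt (by simp)
  exact hs.eq _ _

theorem hasDerivAt_line {n : ℕ} {V : Rn n → ℝ} (hV : Differentiable ℝ V) (x ξ : Rn n) (η : ℝ) :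
    HasDerivAt (fun η : ℝ => V (x + η • ξ)) (∑ j, ξ j * pderivX j V (x + η • ξ)) η := by
  have h1 : HasDerivAt (fun η : ℝ => x + η • ξ) ξ η := by
    simpa using ((hasDerivAt_id η).smul_const ξ).const_add x
  have h2 := (hV (x + η • ξ)).hasFDerivAt.comp_hasDerivAt η h1
  rw [clm_apply_eq_sum] at h2
  exact h2

theorem hasDerivAt_line_deriv {n : ℕ} {U : Rn n → ℝ} (hU : ContDiff ℝ 2 U) (x ξ : Rn n) :
    HasDerivAt (fun η : ℝ => ∑ j, ξ j * pderivX j U (x + η • ξ))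
      (∑ i, ∑ j, pderivX i (pderivX j U) x * ξ i * ξ j) 0 := by
  have h : ∀ j ∈ Finset.univ, HasDerivAt (fun η : ℝ => ξ j * pderivX j U (x + η • ξ))
      (ξ j * ∑ i, ξ i * pderivX i (pderivX j U) (x + (0 : ℝ) • ξ)) 0 := fun j _ =>
    (hasDerivAt_line (differentiable_pderivX hU j) x ξ 0).const_mul (ξ j)
  refine (HasDerivAt.fun_sum h).congr_deriv ?_
  rw [Finset.sum_comm]
  simp only [Finset.mul_sum, zero_smul, add_zero]
  exact Finset.sum_congr rfl fun i _ => Finset.sum_congr rfl fun j _ => by ring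

/-- A `C²` function touched from above at `x` by `y ↦ ε + 1 / (v - k (‖y‖² - ‖x‖²))`. -/
theorem contact_line {n : ℕ} {U : Rn n → ℝ} (hU : ContDiff ℝ 2 U) {x : Rn n} {ε v k : ℝ}
    (hv : 0 < v) (hx : U x = ε + 1 / v)
    (hle : ∀ᶠ y in 𝓝 x, U y ≤ ε + 1 / (v - k * (‖y‖ ^ 2 - ‖x‖ ^ 2))) (ξ : Rn n) :
    (∑ j, ξ j * pderivX j U x = 2 * k * inner ℝ x ξ / v ^ 2) ∧
    ∑ i, ∑ j, pderivX i (pderivX j U) x * ξ i * ξ j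
      ≤ 8 * k ^ 2 * (inner ℝ x ξ) ^ 2 / v ^ 3 + 2 * k * ‖ξ‖ ^ 2 / v ^ 2 := by
  set b : ℝ := inner ℝ x ξ with hb
  set P : ℝ → ℝ := fun η => v - k * (2 * η * b + η ^ 2 * ‖ξ‖ ^ 2) with hP
  have hP0 : P 0 = v := by simp [hP]
  have hPd : ∀ η, HasDerivAt P (-k * (2 * b + 2 * η * ‖ξ‖ ^ 2)) η := by
    intro η
    have h1 : HasDerivAt (fun η : ℝ => 2 * η * b + η ^ 2 * ‖ξ‖ ^ 2)
        (2 * b + 2 * η * ‖ξ‖ ^ 2) η := by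
      have h2 := (((hasDerivAt_id η).const_mul 2).mul_const b).add
        ((hasDerivAt_pow 2 η).mul_const (‖ξ‖ ^ 2))
      refine h2.congr_deriv ?_
      simp
    exact ((h1.const_mul k).const_sub v).congr_deriv (by ring)
  have hPne : ∀ᶠ η in 𝓝 (0 : ℝ), P η ≠ 0 := by
    have : ContinuousAt P 0 := (hPd 0).continuousAt
    exact this.eventually_ne (by rw [hP0]; exact hv.ne')
  have hnorm : ∀ η : ℝ, ‖x + η • ξ‖ ^ 2 - ‖x‖ ^ 2 = 2 * η * b + η ^ 2 * ‖ξ‖ ^ 2 := by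
    intro η
    rw [norm_add_sq_real, real_inner_smul_right, norm_smul, mul_pow, Real.norm_eq_abs, sq_abs]
    ring
  -- Contact makes 0 a local maximum of φ on each line through x; the two claims are its first and
  -- second derivative tests.
  set φ : ℝ → ℝ := fun η => U (x + η • ξ) - 1 / P η with hφ
  have hmax : IsLocalMax φ 0 := by
    have hc : Tendsto (fun η : ℝ => x + η • ξ) (𝓝 0) (𝓝 x) := by
      have : Continuous fun η : ℝ => x + η • ξ := by fun_prop
      simpa using this.tendsto 0
    filter_upwards [hc.eventually hle] with η hη
    simp only [hφ, hP0, zero_smul, add_zero, hx]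
    rw [hnorm] at hη
    have : P η = v - k * (2 * η * b + η ^ 2 * ‖ξ‖ ^ 2) := rfl
    rw [this]
    linarith
  set φ' : ℝ → ℝ := fun η => (∑ j, ξ j * pderivX j U (x + η • ξ))
    - (k * (2 * b + 2 * η * ‖ξ‖ ^ 2)) / P η ^ 2 with hφ'
  have hd1 : ∀ᶠ η in 𝓝 (0 : ℝ), HasDerivAt φ (φ' η) η := by
    filter_upwards [hPne] with η hη
    have h1 := hasDerivAt_line (hU.differentiable (by norm_num)) x ξ η
    have h2 : HasDerivAt (fun η => 1 / P η) ((k * (2 * b + 2 * η * ‖ξ‖ ^ 2)) / P η ^ 2) η := by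
      have := (hPd η).fun_inv hη
      simp only [one_div]
      exact this.congr_deriv (by ring)
    exact h1.sub h2
  have hd2 : HasDerivAt φ' ((∑ i, ∑ j, pderivX i (pderivX j U) x * ξ i * ξ j)
      - (8 * k ^ 2 * b ^ 2 / v ^ 3 + 2 * k * ‖ξ‖ ^ 2 / v ^ 2)) 0 := by
    have h1 := hasDerivAt_line_deriv hU x ξ
    have h3 : HasDerivAt (fun η : ℝ => k * (2 * b + 2 * η * ‖ξ‖ ^ 2)) (k * (2 * ‖ξ‖ ^ 2)) 0 := by
      have := ((((hasDerivAt_id (0 : ℝ)).const_mul 2).mul_const (‖ξ‖ ^ 2)).const_add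
        (2 * b)).const_mul k
      exact this.congr_deriv (by simp)
    have h4 := h3.fun_div ((hPd 0).fun_pow 2) (by rw [hP0]; positivity)
    refine (h1.sub h4).congr_deriv ?_
    rw [hP0]
    field_simp
    ring
  have e1 : φ' 0 = 0 := by
    rw [← hd1.self_of_nhds.deriv]; exact hmax.deriv_eq_zero
  have e2 := hmax.second_deriv_nonpos hd1 hd2
  refine ⟨?_, by linarith⟩
  simp only [hφ', hP0, zero_smul, add_zero] at e1
  have : k * (2 * b + 2 * 0 * ‖ξ‖ ^ 2) / v ^ 2 = 2 * k * b / v ^ 2 := by ring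
  rw [this] at e1
  linarith

theorem contact_gradient {n : ℕ} {U : Rn n → ℝ} (hU : ContDiff ℝ 2 U) {x : Rn n} {ε v k : ℝ}
    (hv : 0 < v) (hx : U x = ε + 1 / v)
    (hle : ∀ᶠ y in 𝓝 x, U y ≤ ε + 1 / (v - k * (‖y‖ ^ 2 - ‖x‖ ^ 2))) :
    gradient U x = (2 * k / v ^ 2) • x := by
  refine ext_inner_right ℝ fun ξ => ?_
  have h := (contact_line hU hv hx hle ξ).1
  rw [gradient, InnerProductSpace.toDual_symm_apply, clm_apply_eq_sum, real_inner_smul_left]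
  simp only [pderivX] at h
  rw [h]
  ring

theorem contact_hessian {n : ℕ} {U : Rn n → ℝ} (hU : ContDiff ℝ 2 U) {x : Rn n} {ε v k : ℝ}
    (hv : 0 < v) (hk : 0 ≤ k) (hx : U x = ε + 1 / v)
    (hle : ∀ᶠ y in 𝓝 x, U y ≤ ε + 1 / (v - k * (‖y‖ ^ 2 - ‖x‖ ^ 2)))
    {A : Matrix (Fin n) (Fin n) ℝ} (hA : ∀ ξ : Fin n → ℝ, 0 ≤ ∑ i, ∑ j, A i j * ξ i * ξ j) :
    ∑ i, ∑ j, A i j * pderivX i (pderivX j U) x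
      ≤ (8 * k ^ 2 * ‖x‖ ^ 2 / v ^ 3 + 2 * k / v ^ 2) * ∑ i, ∑ j, |A i j| := by
  -- W is the Hessian of the touching function; W - D²U is positive semidefinite and can be paired
  -- with A.
  set W : Matrix (Fin n) (Fin n) ℝ := fun i j =>
    8 * k ^ 2 / v ^ 3 * (x i * x j) + 2 * k / v ^ 2 * (if i = j then 1 else 0) with hW
  have h := sum_mul_nonneg_of_form_nonneg (A := A)
    (M := fun i j => W i j - pderivX i (pderivX j U) x) hA
    (fun i j => by simp only [hW, pderivX_comm hU i j, mul_comm (x i), eq_comm (a := i)])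
    (fun ξ => by
      have h2 := (contact_line hU hv hx hle (WithLp.toLp 2 ξ)).2
      have e1 : inner ℝ x (WithLp.toLp 2 ξ) = ∑ i, x i * ξ i := by
        simp [PiLp.inner_apply, mul_comm]
      have e2 : ‖(WithLp.toLp 2 ξ : Rn n)‖ ^ 2 = ∑ i, ξ i ^ 2 := by
        simp [EuclideanSpace.norm_sq_eq]
      rw [e1, e2] at h2
      have e3 : ∑ i, ∑ j, W i j * ξ i * ξ j
          = 8 * k ^ 2 * (∑ i, x i * ξ i) ^ 2 / v ^ 3 + 2 * k * (∑ i, ξ i ^ 2) / v ^ 2 := by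
        have : ∀ i j, W i j * ξ i * ξ j = 8 * k ^ 2 / v ^ 3 * ((x i * ξ i) * (x j * ξ j))
            + 2 * k / v ^ 2 * (if i = j then ξ i * ξ j else 0) := by
          intro i j
          simp only [hW]
          split_ifs <;> ring
        simp only [this, Finset.sum_add_distrib, ← Finset.mul_sum, Finset.sum_ite_eq,
          Finset.mem_univ, if_true]
        rw [← Finset.sum_mul, sq (∑ i, x i * ξ i)]
        simp only [sq]
        ring
      simp only [sub_mul, Finset.sum_sub_distrib, e3]
      simp only at h2
      linarith)
  simp only [mul_sub, Finset.sum_sub_distrib] at h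
  refine (sub_nonneg.1 h).trans ?_
  simp only [Finset.mul_sum]
  refine Finset.sum_le_sum fun i _ => Finset.sum_le_sum fun j _ => ?_
  have hc1 : 0 ≤ 8 * k ^ 2 / v ^ 3 := by positivity
  have hc2 : 0 ≤ 2 * k / v ^ 2 := by positivity
  have hxx : |x i * x j| ≤ ‖x‖ ^ 2 := by
    rw [abs_mul, sq]
    have := PiLp.norm_apply_le x i
    have := PiLp.norm_apply_le x j
    gcongr <;> assumption
  have hWb : |W i j| ≤ 8 * k ^ 2 * ‖x‖ ^ 2 / v ^ 3 + 2 * k / v ^ 2 := by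
    have e : 8 * k ^ 2 * ‖x‖ ^ 2 / v ^ 3 = 8 * k ^ 2 / v ^ 3 * ‖x‖ ^ 2 := by ring
    rw [e]
    refine (abs_add_le _ _).trans (add_le_add ?_ ?_)
    · rw [abs_mul, abs_of_nonneg hc1]
      gcongr
    · rw [abs_mul, abs_of_nonneg hc2]
      refine mul_le_of_le_one_right hc2 ?_
      split_ifs <;> simp
  calc A i j * W i j ≤ |A i j * W i j| := le_abs_self _
    _ = |W i j| * |A i j| := by rw [abs_mul, mul_comm]
    _ ≤ _ := by gcongr

/-! ### The barrier in space. -/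

theorem intervalIntegrable_id_mul_of_antitoneOn {Q : ℝ → ℝ} (hQ : AntitoneOn Q (Ici 1)) {a b : ℝ}
    (ha : 1 ≤ a) (hb : 1 ≤ b) : IntervalIntegrable (fun z => z * Q z) volume a b := by
  have h : IntervalIntegrable Q volume a b :=
    (hQ.mono fun z hz => (le_min ha hb).trans hz.1).intervalIntegrable
  exact h.continuousOn_mul (by fun_prop)

/-- Valid for b on either side of a: the primitive of z Q(z) is concave in z², with supporting slope
Q(a)/2. -/
theorem integral_id_mul_le_of_antitoneOn {Q : ℝ → ℝ} (hQ : AntitoneOn Q (Ici 1)) {a b : ℝ}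
    (ha : 1 ≤ a) (hb : 1 ≤ b) : ∫ z in a..b, z * Q z ≤ Q a / 2 * (b ^ 2 - a ^ 2) := by
  have hlin : ∀ a b c : ℝ, ∫ z in a..b, z * c = c / 2 * (b ^ 2 - a ^ 2) := by
    intro a b c
    rw [intervalIntegral.integral_mul_const, integral_id]
    ring
  have hcont : ∀ c a b : ℝ, IntervalIntegrable (fun z : ℝ => z * c) volume a b := fun c a b =>
    (by fun_prop : Continuous fun z : ℝ => z * c).intervalIntegrable a b
  rw [← hlin]
  rcases le_total a b with hab | hab
  · refine intervalIntegral.integral_mono_on hab (intervalIntegrable_id_mul_of_antitoneOn hQ ha hb)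
      (hcont _ _ _) fun z hz => ?_
    exact mul_le_mul_of_nonneg_left (hQ ha (ha.trans hz.1) hz.1) (by linarith [hz.1])
  · rw [intervalIntegral.integral_symm, intervalIntegral.integral_symm b]
    refine neg_le_neg ?_
    refine intervalIntegral.integral_mono_on hab (hcont _ _ _)
      (intervalIntegrable_id_mul_of_antitoneOn hQ hb ha) fun z hz => ?_
    exact mul_le_mul_of_nonneg_left (hQ (hb.trans hz.1) ha hz.2) (by linarith [hz.1])

theorem antitoneOn_min_inv_sq {q : ℝ → ℝ} (hq : AntitoneOn q (Ici 1)) :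
    AntitoneOn (fun z => min (q z) (1 / z ^ 2)) (Ici 1) := by
  intro a ha b hb hab
  have ha' : (1 : ℝ) ≤ a := ha
  have : 1 / b ^ 2 ≤ 1 / a ^ 2 := by gcongr
  exact min_le_min (hq ha hb hab) this

/-- If the truncated integral converged, its pieces over [R/2, R] would tend to 0. By monotonicity
this forces Q(R) < 1/R², so the truncation is eventually inactive and ∫ r q converges too. -/
theorem tendsto_integral_id_mul_min {q : ℝ → ℝ} (hq0 : ∀ r, 1 ≤ r → 0 ≤ q r)
    (hanti : AntitoneOn q (Ici 1)) (hq : ∫⁻ r in Ioi (1 : ℝ), ENNReal.ofReal (r * q r) = ⊤) :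
    Tendsto (fun R => ∫ z in (1 : ℝ)..R, z * min (q z) (1 / z ^ 2)) atTop atTop := by
  set Q : ℝ → ℝ := fun z => min (q z) (1 / z ^ 2) with hQdef
  have hQ : AntitoneOn Q (Ici 1) := antitoneOn_min_inv_sq hanti
  have hQ0 : ∀ z, 1 ≤ z → 0 ≤ z * Q z := fun z hz =>
    mul_nonneg (by linarith) (le_min (hq0 z hz) (by positivity))
  have hint : ∀ a b : ℝ, 1 ≤ a → 1 ≤ b → IntervalIntegrable (fun z => z * Q z) volume a b :=
    fun a b ha hb => intervalIntegrable_id_mul_of_antitoneOn hQ ha hb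
  have hmono : ∀ a b : ℝ, 1 ≤ a → a ≤ b →
      ∫ z in (1 : ℝ)..a, z * Q z ≤ ∫ z in (1 : ℝ)..b, z * Q z := by
    intro a b ha hab
    rw [← intervalIntegral.integral_add_adjacent_intervals (hint 1 a le_rfl ha)
      (hint a b ha (ha.trans hab))]
    have : 0 ≤ ∫ z in a..b, z * Q z :=
      intervalIntegral.integral_nonneg hab fun z hz => hQ0 z (ha.trans hz.1)
    linarith
  by_contra hnot
  obtain ⟨C, hC⟩ : ∃ C, ∀ R, 1 ≤ R → ∫ z in (1 : ℝ)..R, z * Q z ≤ C := by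
    by_contra! hcon
    refine hnot (tendsto_atTop.2 fun C => ?_)
    obtain ⟨R, hR, hCR⟩ := hcon C
    filter_upwards [eventually_ge_atTop R] with b hb
    exact hCR.le.trans (hmono R b hR hb)
  have hI : IntegrableOn (fun z => z * Q z) (Ioi 1) := by
    refine integrableOn_Ioi_of_intervalIntegral_norm_bounded (l := atTop) (b := id) C 1
      (fun R => ?_) tendsto_id ?_
    · rcases le_total 1 R with h | h
      · exact (intervalIntegrable_iff_integrableOn_Ioc_of_le h).1 (hint 1 R le_rfl h)
      · simp [Ioc_eq_empty (not_lt.2 h)]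
    · filter_upwards [eventually_ge_atTop 1] with R hR
      refine le_of_eq_of_le ?_ (hC R hR)
      refine intervalIntegral.integral_congr fun z hz => ?_
      simp only [id, uIcc_of_le hR] at hz
      exact Real.norm_of_nonneg (hQ0 z hz.1)
  have hlim := intervalIntegral_tendsto_integral_Ioi 1 hI tendsto_id
  have hhalf : Tendsto (fun R : ℝ => R / 2) atTop atTop := tendsto_id.atTop_div_const (by norm_num)
  have hdiff := hlim.sub (hlim.comp hhalf)
  rw [sub_self] at hdiff
  -- The piece over [R/2, R] is at least Q(R)(R² - R²/4)/2 = (3/8) Q(R) R².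
  have hev : ∀ᶠ R in atTop, Q R = q R := by
    filter_upwards [hdiff.eventually (gt_mem_nhds (by norm_num : (0 : ℝ) < 3 / 8)),
      eventually_ge_atTop 2] with R hR h2
    have h1R : 1 ≤ R / 2 := by linarith
    simp only [id, Function.comp] at hR
    rw [← intervalIntegral.integral_add_adjacent_intervals (hint 1 (R / 2) le_rfl h1R)
      (hint (R / 2) R h1R (by linarith)), intervalIntegral.integral_symm R (R / 2)] at hR
    have := integral_id_mul_le_of_antitoneOn hQ (a := R) (b := R / 2) (by linarith) h1R
    have hlt : Q R * R ^ 2 < 1 := by nlinarith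
    refine min_eq_left (le_of_lt ?_)
    by_contra! hle
    have : Q R = 1 / R ^ 2 := min_eq_right hle
    rw [this] at hlt
    have : 1 / R ^ 2 * R ^ 2 = 1 := by field_simp
    linarith
  obtain ⟨R0, hR0⟩ := eventually_atTop.1 (hev.and (eventually_ge_atTop 1))
  have h1R0 : 1 ≤ R0 := (hR0 R0 le_rfl).2
  have htail : ∫⁻ r in Ioi R0, ENNReal.ofReal (r * q r) < ⊤ := by
    have : ∫⁻ r in Ioi R0, ENNReal.ofReal (r * q r) = ∫⁻ r in Ioi R0, ENNReal.ofReal (r * Q r) :=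
      setLIntegral_congr_fun measurableSet_Ioi fun r hr => by
        simp only [(hR0 r (le_of_lt hr)).1]
    rw [this]
    exact (hI.mono_set (Ioi_subset_Ioi h1R0)).lintegral_lt_top
  have hhead : ∫⁻ r in Ioc 1 R0, ENNReal.ofReal (r * q r) < ⊤ :=
    ((intervalIntegrable_iff_integrableOn_Ioc_of_le h1R0).1
      (intervalIntegrable_id_mul_of_antitoneOn hanti le_rfl h1R0)).lintegral_lt_top
  rw [← Ioc_union_Ioi_eq_Ioi h1R0] at hq
  have := (lintegral_union_le (μ := volume) (fun r => ENNReal.ofReal (r * q r)) (Ioc 1 R0) (Ioi R0))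
  rw [hq] at this
  exact absurd (ENNReal.add_lt_top.2 ⟨hhead, htail⟩) (not_lt.2 this)

theorem ballInf_le {n : ℕ} {p : Rn n → ℝ} (hp : ∀ x, 0 ≤ p x) {x : Rn n} {r : ℝ}
    (hx : ‖x‖ < r) : ballInf p r ≤ p x :=
  csInf_le ⟨0, by rintro _ ⟨y, -, rfl⟩; exact hp y⟩ ⟨x, by simpa using hx, rfl⟩

theorem ballInf_nonneg {n : ℕ} {p : Rn n → ℝ} (hp : ∀ x, 0 ≤ p x) (r : ℝ) : 0 ≤ ballInf p r :=
  Real.sInf_nonneg (by rintro _ ⟨y, -, rfl⟩; exact hp y)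

theorem antitoneOn_ballInf {n : ℕ} {p : Rn n → ℝ} (hp : ∀ x, 0 ≤ p x) :
    AntitoneOn (ballInf p) (Ici 1) := by
  intro a ha b hb hab
  have ha' : (1 : ℝ) ≤ a := ha
  exact csInf_le_csInf ⟨0, by rintro _ ⟨y, -, rfl⟩; exact hp y⟩
    ((Metric.nonempty_ball.2 (by linarith)).image p) (image_mono (Metric.ball_subset_ball hab))

/-- A zero of the antitone q would annihilate the tail and make the integral finite. -/
theorem ballInf_pos {n : ℕ} {p : Rn n → ℝ} (hp : ∀ x, 0 ≤ p x)
    (hq : ∫⁻ r in Ioi (1 : ℝ), ENNReal.ofReal (r * ballInf p r) = ⊤) {r : ℝ} (hr : 1 ≤ r) :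
    0 < ballInf p r := by
  refine (ballInf_nonneg hp r).lt_of_ne' fun h0 => ?_
  have hanti := antitoneOn_ballInf hp
  have hhead : ∫⁻ z in Ioc 1 r, ENNReal.ofReal (z * ballInf p z) < ⊤ :=
    ((intervalIntegrable_iff_integrableOn_Ioc_of_le hr).1
      (intervalIntegrable_id_mul_of_antitoneOn hanti le_rfl hr)).lintegral_lt_top
  have htail : ∫⁻ z in Ioi r, ENNReal.ofReal (z * ballInf p z) = 0 := by
    rw [setLIntegral_congr_fun (g := fun _ => 0) measurableSet_Ioi, lintegral_zero]
    intro z hz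
    have hz' : r ≤ z := le_of_lt hz
    have : ballInf p z = 0 :=
      le_antisymm ((hanti hr (hr.trans hz') hz').trans h0.le) (ballInf_nonneg hp z)
    simp [this]
  rw [← Ioc_union_Ioi_eq_Ioi hr] at hq
  have := (lintegral_union_le (μ := volume) (fun z => ENNReal.ofReal (z * ballInf p z)) (Ioc 1 r)
    (Ioi r))
  rw [hq, htail, add_zero] at this
  exact absurd hhead (not_lt.2 this)

/-- A function `Φ` of `‖x‖`, concave in `‖x‖ ^ 2` with slopes `m / 2` controlled by `p`,
that tends to infinity. -/
theorem exists_space_barrier {n : ℕ} {p : Rn n → ℝ} (hp : ∀ x, 0 ≤ p x)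
    (hq : ∫⁻ r in Ioi (1 : ℝ), ENNReal.ofReal (r * ballInf p r) = ⊤) :
    ∃ Φ m : Rn n → ℝ, Continuous Φ ∧ (∀ x, 0 ≤ Φ x) ∧ (∀ x, 0 < m x) ∧ (∀ x, m x ≤ p x) ∧
      (∀ x, m x * ‖x‖ ^ 2 ≤ 1) ∧ (∀ x y, Φ y ≤ Φ x + m x / 2 * (‖y‖ ^ 2 - ‖x‖ ^ 2)) ∧
      ∀ D, ∃ R δ, 0 < δ ∧ ∀ x, Φ x ≤ D → ‖x‖ ≤ R ∧ δ ≤ p x := by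
  -- The first entry gives m ≤ p, the second m‖x‖² ≤ 1.
  set Q : ℝ → ℝ := fun z => min (ballInf p z) (1 / z ^ 2) with hQdef
  have hQ : AntitoneOn Q (Ici 1) := antitoneOn_min_inv_sq (antitoneOn_ballInf hp)
  have hlim := tendsto_integral_id_mul_min (fun r _ => ballInf_nonneg hp r)
    (antitoneOn_ballInf hp) hq
  -- This radius stays in [1, ∞), strictly exceeds ‖x‖ so that x lies in the open ball, and its
  -- square differs from ‖x‖² by a constant.
  set ρ : Rn n → ℝ := fun x => √(1 + ‖x‖ ^ 2) with hρ
  have hρ2 : ∀ x, ρ x ^ 2 = 1 + ‖x‖ ^ 2 := fun x => Real.sq_sqrt (by positivity)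
  have hρ1 : ∀ x, 1 ≤ ρ x := fun x => Real.one_le_sqrt.2 (by nlinarith [sq_nonneg ‖x‖])
  have hρx : ∀ x, ‖x‖ < ρ x := fun x => Real.lt_sqrt_of_sq_lt (by linarith)
  have hint : ∀ a b : ℝ, 1 ≤ a → 1 ≤ b → IntervalIntegrable (fun z => z * Q z) volume a b :=
    fun a b ha hb => intervalIntegrable_id_mul_of_antitoneOn hQ ha hb
  have hQ0 : ∀ z, 1 ≤ z → 0 < Q z := fun z hz =>
    lt_min (ballInf_pos hp hq hz) (by positivity)
  refine ⟨fun x => ∫ z in (1 : ℝ)..ρ x, z * Q z, fun x => Q (ρ x), ?_, ?_, ?_, ?_, ?_, ?_, ?_⟩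
  · refine continuous_iff_continuousAt.2 fun x => ?_
    have hc : ContinuousOn (fun b => ∫ z in (1 : ℝ)..b, z * Q z) (Icc 1 (ρ x + 1)) := by
      have := intervalIntegral.continuousOn_primitive_interval (μ := volume)
        (f := fun z => z * Q z) (a := 1) (b := ρ x + 1) (by
          rw [uIcc_of_le (by linarith [hρ1 x]), integrableOn_Icc_iff_integrableOn_Ioc]
          exact (intervalIntegrable_iff_integrableOn_Ioc_of_le (by linarith [hρ1 x])).1
            (hint _ _ le_rfl (by linarith [hρ1 x])))
      rwa [uIcc_of_le (by linarith [hρ1 x])] at this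
    have hρc : Continuous ρ := by fun_prop
    have h1 : Tendsto ρ (𝓝 x) (𝓝[Icc 1 (ρ x + 1)] (ρ x)) := by
      refine tendsto_nhdsWithin_iff.2 ⟨hρc.continuousAt, ?_⟩
      filter_upwards [hρc.continuousAt.eventually (gt_mem_nhds (lt_add_one (ρ x)))] with y hy
      exact ⟨hρ1 y, hy.le⟩
    exact (hc (ρ x) ⟨hρ1 x, by linarith⟩).tendsto.comp h1
  · intro x
    exact intervalIntegral.integral_nonneg (hρ1 x) fun z hz =>
      mul_nonneg (by linarith [hz.1]) (hQ0 z hz.1).le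
  · exact fun x => hQ0 _ (hρ1 x)
  · exact fun x => (min_le_left _ _).trans (ballInf_le hp (hρx x))
  · intro x
    have h1 : Q (ρ x) ≤ 1 / ρ x ^ 2 := min_le_right _ _
    have h2 : 0 < ρ x ^ 2 := by have := hρ1 x; positivity
    calc Q (ρ x) * ‖x‖ ^ 2 ≤ 1 / ρ x ^ 2 * ρ x ^ 2 :=
          mul_le_mul h1 (by linarith [hρ2 x]) (by positivity) (by positivity)
      _ = 1 := one_div_mul_cancel h2.ne'
  · intro x y
    have h1 := integral_id_mul_le_of_antitoneOn hQ (hρ1 x) (hρ1 y)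
    beta_reduce
    rw [← intervalIntegral.integral_add_adjacent_intervals (hint 1 (ρ x) le_rfl (hρ1 x))
      (hint _ _ (hρ1 x) (hρ1 y))]
    rw [hρ2, hρ2] at h1
    ring_nf at h1 ⊢
    linarith
  · intro D
    obtain ⟨R, hR⟩ := eventually_atTop.1 (hlim.eventually_gt_atTop D)
    refine ⟨max R 1, ballInf p (max R 1), ballInf_pos hp hq (le_max_right _ _), fun x hx => ?_⟩
    have : ρ x < R := by
      by_contra! h
      exact absurd (hR _ h) (not_lt.2 hx)
    have hxR : ‖x‖ < max R 1 := (hρx x).trans (this.trans_le (le_max_left _ _))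
    exact ⟨hxR.le, ballInf_le hp hxR⟩

/-! ### The barrier in the values of u. -/

/-- Primitive of an antitone function on `(0, ∞)`, integrable at `0`. -/
theorem exists_concave_primitive {N : ℝ → ℝ} (hN : AntitoneOn N (Ioi 0))
    (hN1 : ∀ τ, 0 < τ → 1 ≤ N τ) (hint : IntegrableOn N (Ioc 0 1)) :
    ∃ Γ : ℝ → ℝ, ContinuousOn Γ (Ioi 0) ∧ (∀ τ, 0 < τ → 0 < Γ τ) ∧
      ∀ τ σ, 0 < τ → 0 < σ → Γ σ ≤ Γ τ + N τ * (σ - τ) := by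
  have hpos : ∀ a b, 0 < a → 0 < b → IntervalIntegrable N volume a b := fun a b ha hb =>
    (hN.mono fun z hz => (lt_min ha hb).trans_le hz.1).intervalIntegrable
  have h01 : IntervalIntegrable N volume 0 1 :=
    (intervalIntegrable_iff_integrableOn_Ioc_of_le zero_le_one).2 hint
  have h0 : ∀ b, 0 < b → IntervalIntegrable N volume 0 b := fun b hb =>
    h01.trans (hpos 1 b one_pos hb)
  refine ⟨fun τ => ∫ z in (0 : ℝ)..τ, N z, ?_, ?_, ?_⟩
  · intro τ hτ
    have hτ' : (0 : ℝ) < τ := hτ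
    have hc := intervalIntegral.continuousOn_primitive_interval (μ := volume) (f := N) (a := 0)
      (b := τ + 1) (by
        rw [uIcc_of_le (by linarith), integrableOn_Icc_iff_integrableOn_Ioc]
        exact (intervalIntegrable_iff_integrableOn_Ioc_of_le (by linarith)).1
          (h0 _ (by linarith)))
    rw [uIcc_of_le (by linarith)] at hc
    exact (hc.continuousAt (Icc_mem_nhds hτ' (by linarith))).continuousWithinAt
  · intro τ hτ
    have h1 : ∫ z in (0 : ℝ)..τ, (1 : ℝ) ≤ ∫ z in (0 : ℝ)..τ, N z :=
      intervalIntegral.integral_mono_on_of_le_Ioo hτ.le (by simp) (h0 τ hτ)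
        fun z hz => hN1 z hz.1
    simp only [intervalIntegral.integral_const, sub_zero, smul_eq_mul, mul_one] at h1
    linarith
  · intro τ σ hτ hσ
    beta_reduce
    rw [← intervalIntegral.integral_add_adjacent_intervals (h0 τ hτ) (hpos τ σ hτ hσ)]
    refine add_le_add le_rfl ?_
    have hconst : ∀ a b c : ℝ, ∫ _ in a..b, c = c * (b - a) := by
      intro a b c
      rw [intervalIntegral.integral_const, smul_eq_mul, mul_comm]
    rw [← hconst]
    rcases le_total τ σ with h | h
    · refine intervalIntegral.integral_mono_on h (hpos τ σ hτ hσ) (by simp) fun z hz => ?_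
      exact hN hτ (hτ.trans_le hz.1) hz.1
    · rw [intervalIntegral.integral_symm, intervalIntegral.integral_symm σ]
      refine neg_le_neg (intervalIntegral.integral_mono_on h (by simp) (hpos σ τ hσ hτ)
        fun z hz => ?_)
      exact hN (hσ.trans_le hz.1) hτ hz.2

theorem IsPositiveWeight.infNear_le {φ : ℝ → ℝ} (hφ : IsPositiveWeight φ) {θ ζ z : ℝ}
    (hθ : 1 < θ) (hζ : 0 < ζ) (hz : z ∈ Ioo (ζ / θ) (θ * ζ)) : infNear θ φ ζ ≤ φ z := by
  refine csInf_le ⟨0, ?_⟩ ⟨z, hz, rfl⟩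
  rintro _ ⟨y, hy, rfl⟩
  exact (hφ.pos y ((by positivity : 0 < ζ / θ).trans hy.1)).le

theorem self_mem_Ioo_div_mul {θ ζ : ℝ} (hθ : 1 < θ) (hζ : 0 < ζ) : ζ ∈ Ioo (ζ / θ) (θ * ζ) :=
  ⟨div_lt_self hζ hθ, by nlinarith⟩

theorem IsPositiveWeight.infNear_pos {φ : ℝ → ℝ} (hφ : IsPositiveWeight φ) {θ ζ : ℝ}
    (hθ : 1 < θ) (hζ : 0 < ζ) : 0 < infNear θ φ ζ := by
  have h0 : 0 < ζ / θ := by positivity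
  obtain ⟨c, hc, hcl⟩ := hφ.inf_pos (Icc (ζ / θ) (θ * ζ)) isCompact_Icc
    fun z hz => h0.trans_le hz.1
  refine hc.trans_le (le_csInf ?_ ?_)
  · exact ⟨φ ζ, ζ, self_mem_Ioo_div_mul hθ hζ, rfl⟩
  · rintro _ ⟨y, hy, rfl⟩
    exact hcl y (Ioo_subset_Icc_self hy)

/-- On (0, ∞) the sublevel sets are open: z ∈ (ζ/θ, θζ) is equivalent to ζ ∈ (z/θ, θz), so each is a
union of open intervals. -/
theorem IsPositiveWeight.measurable_indicator_infNear {φ : ℝ → ℝ} (hφ : IsPositiveWeight φ)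
    {θ : ℝ} (hθ : 1 < θ) : Measurable ((Ioi 0).indicator (infNear θ φ)) := by
  have hθ0 : 0 < θ := one_pos.trans hθ
  refine measurable_of_Iio fun c => ?_
  have : (Ioi 0).indicator (infNear θ φ) ⁻¹' Iio c
      = (Iic 0 ∩ {_ζ | 0 < c}) ∪ ⋃ z ∈ {z | 0 < z ∧ φ z < c}, Ioo (z / θ) (θ * z) := by
    ext ζ
    rcases lt_or_ge 0 ζ with hζ | hζ
    · have hmem : ζ ∈ Ioi (0 : ℝ) := hζ
      simp only [mem_preimage, indicator_of_mem hmem, mem_Iio, mem_union, mem_inter_iff, mem_Iic,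
        not_le.2 hζ, false_and, false_or, mem_iUnion, exists_prop]
      constructor
      · intro h
        obtain ⟨_, ⟨z, hz, rfl⟩, hzc⟩ := exists_lt_of_csInf_lt
          (⟨φ ζ, ζ, self_mem_Ioo_div_mul hθ hζ, rfl⟩ : (φ '' Ioo (ζ / θ) (θ * ζ)).Nonempty) h
        have hz1 := (div_lt_iff₀ hθ0).1 hz.1
        refine ⟨z, ⟨(by positivity : 0 < ζ / θ).trans hz.1, hzc⟩, ?_, by linarith⟩
        rw [div_lt_iff₀ hθ0]
        linarith [hz.2]
      · rintro ⟨z, ⟨hz0, hzc⟩, h1, h2⟩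
        refine (hφ.infNear_le hθ hζ ⟨?_, ?_⟩).trans_lt hzc
        · rw [div_lt_iff₀ hθ0]; linarith
        · rw [div_lt_iff₀ hθ0] at h1; linarith
    · have hmem : ζ ∉ Ioi (0 : ℝ) := not_lt.2 hζ
      simp only [mem_preimage, indicator_of_notMem hmem, mem_Iio, mem_union, mem_inter_iff,
        mem_Iic, hζ, true_and, mem_ofPred_eq, mem_iUnion, exists_prop]
      refine ⟨Or.inl, fun h => h.resolve_right ?_⟩
      rintro ⟨z, ⟨hz0, -⟩, h1, -⟩
      exact absurd h1 (not_lt.2 (hζ.trans (by positivity)))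
  rw [this]
  refine (measurableSet_Iic.inter (MeasurableSet.const _)).union (IsOpen.measurableSet ?_)
  exact isOpen_biUnion fun _ _ => isOpen_Ioo

theorem IsPositiveWeight.aemeasurable_infNear {φ : ℝ → ℝ} (hφ : IsPositiveWeight φ)
    {θ : ℝ} (hθ : 1 < θ) : AEMeasurable (infNear θ φ) (volume.restrict (Ioi 1)) := by
  refine ⟨_, hφ.measurable_indicator_infNear hθ, ?_⟩
  filter_upwards [ae_restrict_mem measurableSet_Ioi] with ζ hζ
  have h1 : (1 : ℝ) < ζ := hζ
  have : ζ ∈ Ioi (0 : ℝ) := one_pos.trans h1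
  rw [indicator_of_mem this]

theorem integrableOn_id_mul {P : ℝ → ℝ} (hP : IntegrableOn P (Ioi 1)) (z : ℝ) :
    IntegrableOn (fun y => y * P y) (Ioc 1 z) := by
  refine (hP.mono_set Ioc_subset_Ioi_self).bdd_mul (c := z)
    (by fun_prop : AEStronglyMeasurable (fun y : ℝ => y) _) ?_
  filter_upwards [ae_restrict_mem measurableSet_Ioc] with y hy
  rw [Real.norm_of_nonneg (by linarith [hy.1])]
  exact hy.2

theorem setIntegral_id_mul_mono {P : ℝ → ℝ} (hP : IntegrableOn P (Ioi 1))
    (hP0 : ∀ y, 1 < y → 0 ≤ P y) : Monotone fun z => ∫ y in Ioc 1 z, y * P y := by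
  intro a b hab
  refine setIntegral_mono_set (integrableOn_id_mul hP b) ?_
    (Ioc_subset_Ioc_right hab).eventuallyLE
  filter_upwards [ae_restrict_mem measurableSet_Ioc] with y hy
  exact mul_nonneg (by linarith [hy.1]) (hP0 y hy.1)

theorem setIntegral_id_mul_nonneg {P : ℝ → ℝ} (hP0 : ∀ y, 1 < y → 0 ≤ P y) (z : ℝ) :
    0 ≤ ∫ y in Ioc 1 z, y * P y :=
  setIntegral_nonneg measurableSet_Ioc fun y hy =>
    mul_nonneg (by linarith [hy.1]) (hP0 y hy.1)

theorem setIntegral_id_mul_le {P : ℝ → ℝ} (hP : IntegrableOn P (Ioi 1))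
    (hP0 : ∀ y, 1 < y → 0 ≤ P y) {z : ℝ} (hz : 0 ≤ z) :
    ∫ y in Ioc 1 z, y * P y ≤ z * ∫ y in Ioi 1, P y := by
  have hP' : IntegrableOn P (Ioc 1 z) := hP.mono_set Ioc_subset_Ioi_self
  calc ∫ y in Ioc 1 z, y * P y ≤ ∫ y in Ioc 1 z, z * P y :=
        setIntegral_mono_on (integrableOn_id_mul hP z) (hP'.const_mul z) measurableSet_Ioc
          fun y hy => mul_le_mul_of_nonneg_right hy.2 (hP0 y hy.1)
    _ = z * ∫ y in Ioc 1 z, P y := integral_const_mul _ _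
    _ ≤ z * ∫ y in Ioi 1, P y := by
        refine mul_le_mul_of_nonneg_left (setIntegral_mono_set hP ?_
          Ioc_subset_Ioi_self.eventuallyLE) hz
        filter_upwards [ae_restrict_mem measurableSet_Ioi] with y hy using hP0 y hy

theorem mul_sq_le_setIntegral_id_mul {P : ℝ → ℝ} (hP : IntegrableOn P (Ioi 1))
    (hP0 : ∀ y, 1 < y → 0 ≤ P y) {θ ζ w : ℝ} (hθ : 1 < θ) (hζ : θ ≤ ζ)
    (hw : ∀ y ∈ Ioo (ζ / θ) ζ, w ≤ P y) :
    w * ζ ^ 2 ≤ 2 / (1 - (1 / θ) ^ 2) * ∫ y in Ioc 1 ζ, y * P y := by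
  have hθ0 : 0 < θ := one_pos.trans hθ
  have h1 : 1 ≤ ζ / θ := (one_le_div hθ0).2 hζ
  have hlt : ζ / θ ≤ ζ := div_le_self (hθ0.le.trans hζ) hθ.le
  have h2 : ∫ y in ζ / θ..ζ, y * w ≤ ∫ y in Ioc 1 ζ, y * P y := by
    calc ∫ y in ζ / θ..ζ, y * w ≤ ∫ y in ζ / θ..ζ, y * P y := by
          refine intervalIntegral.integral_mono_on_of_le_Ioo hlt
            ((by fun_prop : Continuous fun y : ℝ => y * w).intervalIntegrable _ _) ?_
            fun y hy => mul_le_mul_of_nonneg_left (hw y hy) (by linarith [hy.1])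
          rw [intervalIntegrable_iff_integrableOn_Ioc_of_le hlt]
          exact (integrableOn_id_mul hP ζ).mono_set (Ioc_subset_Ioc_left h1)
      _ = ∫ y in Ioc (ζ / θ) ζ, y * P y := intervalIntegral.integral_of_le hlt
      _ ≤ _ := by
          refine setIntegral_mono_set (integrableOn_id_mul hP ζ) ?_
            (Ioc_subset_Ioc_left h1).eventuallyLE
          filter_upwards [ae_restrict_mem measurableSet_Ioc] with y hy
          exact mul_nonneg (by linarith [hy.1]) (hP0 y hy.1)
  rw [intervalIntegral.integral_mul_const, integral_id] at h2
  have h3 : 0 < 1 - (1 / θ) ^ 2 := by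
    have : (1 / θ) < 1 := (div_lt_one hθ0).2 hθ
    have : 0 < 1 / θ := by positivity
    nlinarith
  rw [div_mul_eq_mul_div, le_div_iff₀ h3]
  have : (ζ ^ 2 - (ζ / θ) ^ 2) / 2 * w = w * ζ ^ 2 * (1 - (1 / θ) ^ 2) / 2 := by ring
  rw [this] at h2
  linarith

/-- By Tonelli, y P(y) gets weighted by the length of {τ : y ≤ 1/τ + ε}, at most 1/(y - ε). This
leaves at most 2∫P. -/
theorem integrableOn_setIntegral_id_mul {P : ℝ → ℝ} (hP : IntegrableOn P (Ioi 1))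
    (hP0 : ∀ y, 1 < y → 0 ≤ P y) {ε : ℝ} (hε : 0 < ε) (hε' : ε ≤ 1 / 2) :
    IntegrableOn (fun τ => ∫ y in Ioc 1 (1 / τ + ε), y * P y) (Ioc 0 1) := by
  have hmeas : AEStronglyMeasurable (fun τ => ∫ y in Ioc 1 (1 / τ + ε), y * P y)
      (volume.restrict (Ioc 0 1)) := by
    have h1 : Measurable fun z => ∫ y in Ioc 1 z, y * P y := (setIntegral_id_mul_mono hP hP0).measurable
    exact (h1.comp (by fun_prop : Measurable fun τ : ℝ => 1 / τ + ε)).aestronglyMeasurable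
  refine ⟨hmeas, ?_⟩
  rw [hasFiniteIntegral_iff_ofReal
    (Eventually.of_forall fun τ => setIntegral_id_mul_nonneg hP0 _)]
  set S : Set (ℝ × ℝ) := {z | z.2 ≤ 1 / z.1 + ε} with hS
  have hSm : MeasurableSet S := measurableSet_le (by fun_prop) (by fun_prop)
  set f : ℝ → ℝ → ENNReal := fun τ y => S.indicator (fun z => ENNReal.ofReal (z.2 * P z.2)) (τ, y)
    with hf
  have e1 : ∀ τ, ENNReal.ofReal (∫ y in Ioc 1 (1 / τ + ε), y * P y)
      = ∫⁻ y in Ioi 1, f τ y := by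
    intro τ
    rw [ofReal_integral_eq_lintegral_ofReal (integrableOn_id_mul hP _)]
    · have : Ioc 1 (1 / τ + ε) = Iic (1 / τ + ε) ∩ Ioi 1 := by
        rw [inter_comm]; rfl
      rw [this, ← Measure.restrict_restrict measurableSet_Iic,
        ← lintegral_indicator measurableSet_Iic]
      rfl
    · filter_upwards [ae_restrict_mem measurableSet_Ioc] with y hy
      exact mul_nonneg (by linarith [hy.1]) (hP0 y hy.1)
  have hfm : AEMeasurable (Function.uncurry f)
      ((volume.restrict (Ioc (0 : ℝ) 1)).prod (volume.restrict (Ioi (1 : ℝ)))) := by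
    have h1 : AEMeasurable (fun y => ENNReal.ofReal (y * P y)) (volume.restrict (Ioi (1 : ℝ))) :=
      (aemeasurable_id.mul hP.aemeasurable).ennreal_ofReal
    exact (h1.comp_snd (μ := volume.restrict (Ioc (0 : ℝ) 1))).indicator hSm
  simp only [e1]
  rw [lintegral_lintegral_swap hfm]
  refine lt_of_le_of_lt (setLIntegral_mono_ae (g := fun y => 2 * ENNReal.ofReal (P y))
    (hP.aemeasurable.ennreal_ofReal.const_mul 2) ?_) ?_
  · refine Eventually.of_forall fun y hy => ?_
    have hy1 : (1 : ℝ) < y := hy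
    have hye : 0 < y - ε := by linarith
    have h1 : ∀ τ ∈ Ioc (0 : ℝ) 1, f τ y
        ≤ (Ioc 0 (1 / (y - ε))).indicator (fun _ => ENNReal.ofReal (y * P y)) τ := by
      intro τ hτ
      by_cases h : (τ, y) ∈ S
      · have h' : y ≤ 1 / τ + ε := h
        have : τ ∈ Ioc 0 (1 / (y - ε)) := by
          refine ⟨hτ.1, ?_⟩
          rw [le_div_comm₀ hτ.1 hye]
          linarith
        simp only [hf, indicator_of_mem h, indicator_of_mem this, le_refl]
      · simp only [hf, indicator_of_notMem h, zero_le]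
    calc ∫⁻ τ in Ioc 0 1, f τ y
        ≤ ∫⁻ τ in Ioc 0 1,
            (Ioc 0 (1 / (y - ε))).indicator (fun _ => ENNReal.ofReal (y * P y)) τ :=
          setLIntegral_mono' measurableSet_Ioc h1
      _ ≤ ∫⁻ τ, (Ioc 0 (1 / (y - ε))).indicator (fun _ => ENNReal.ofReal (y * P y)) τ :=
          setLIntegral_le_lintegral _ _
      _ = ENNReal.ofReal (y * P y) * ENNReal.ofReal (1 / (y - ε)) := by
          rw [lintegral_indicator_const measurableSet_Ioc, Real.volume_Ioc, sub_zero]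
      _ = ENNReal.ofReal (y * P y * (1 / (y - ε))) :=
          (ENNReal.ofReal_mul (mul_nonneg (by linarith) (hP0 y hy1))).symm
      _ ≤ ENNReal.ofReal (2 * P y) := by
          refine ENNReal.ofReal_le_ofReal ?_
          rw [mul_one_div, div_le_iff₀ hye]
          -- Since y > 1 and ε ≤ 1/2, y ≤ 2(y - ε).
          nlinarith [hP0 y hy1]
      _ = 2 * ENNReal.ofReal (P y) := by
          rw [ENNReal.ofReal_mul (by norm_num)]; simp
  · rw [lintegral_const_mul'' _ hP.aemeasurable.ennreal_ofReal]
    exact ENNReal.mul_lt_top (by simp) hP.lintegral_lt_top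

/-- P is the sum of the two integrands. Its moment ∫ y P is monotone in ζ, which pointwise
expressions in g and h need not be, and still bounds them: averaging over (ζ/θ, ζ) recovers the
values at ζ. -/
theorem exists_integrable_majorant {g h : ℝ → ℝ} (hg : IsPositiveWeight g) (hh : IsPositiveWeight h)
    {θ : ℝ} (hθ : 1 < θ)
    (hgθ : ∫⁻ ζ in Ioi (1 : ℝ), ENNReal.ofReal ((infNear θ g ζ * ζ) ^ (-(1 / 2) : ℝ)) < ⊤)
    (hhθ : ∫⁻ ζ in Ioi (1 : ℝ), ENNReal.ofReal (1 / infNear θ h ζ) < ⊤) :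
    ∃ (P : ℝ → ℝ) (κ : ℝ), 0 < κ ∧ IntegrableOn P (Ioi 1) ∧ (∀ y, 1 < y → 0 ≤ P y) ∧
      (∀ ζ, θ ≤ ζ → ζ ^ 2 ≤ κ * (∫ y in Ioc 1 ζ, y * P y) * h ζ) ∧
      ∀ ζ, θ ≤ ζ → ζ ^ 3 ≤ κ ^ 2 * (∫ y in Ioc 1 ζ, y * P y) ^ 2 * g ζ := by
  have hθ0 : 0 < θ := one_pos.trans hθ
  set P : ℝ → ℝ := fun y => 1 / infNear θ h y + (infNear θ g y * y) ^ (-(1 / 2) : ℝ) with hPdef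
  have hP1 : ∀ y, 1 < y → 0 ≤ 1 / infNear θ h y := fun y hy =>
    (one_div_pos.2 (hh.infNear_pos hθ (by linarith))).le
  have hP2 : ∀ y, 1 < y → 0 ≤ (infNear θ g y * y) ^ (-(1 / 2) : ℝ) := fun y hy =>
    Real.rpow_nonneg (mul_nonneg (hg.infNear_pos hθ (by linarith)).le (by linarith)) _
  have hP0 : ∀ y, 1 < y → 0 ≤ P y := fun y hy => add_nonneg (hP1 y hy) (hP2 y hy)
  have hP : IntegrableOn P (Ioi 1) := by
    refine Integrable.add ⟨?_, ?_⟩ ⟨?_, ?_⟩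
    · exact (aemeasurable_const.div (hh.aemeasurable_infNear hθ)).aestronglyMeasurable
    · rwa [hasFiniteIntegral_iff_ofReal]
      filter_upwards [ae_restrict_mem measurableSet_Ioi] with y hy using hP1 y hy
    · exact (((hg.aemeasurable_infNear hθ).mul aemeasurable_id).pow_const _).aestronglyMeasurable
    · rwa [hasFiniteIntegral_iff_ofReal]
      filter_upwards [ae_restrict_mem measurableSet_Ioi] with y hy using hP2 y hy
  set J : ℝ → ℝ := fun z => ∫ y in Ioc 1 z, y * P y with hJ
  set κ : ℝ := 2 / (1 - (1 / θ) ^ 2) with hκ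
  have hκ0 : 0 < κ := by
    have h1 : (1 / θ) < 1 := (div_lt_one hθ0).2 hθ
    have h2 : 0 < 1 / θ := by positivity
    have : 0 < 1 - (1 / θ) ^ 2 := by nlinarith
    positivity
  -- For such y the infima defining `infNear` at y include the value at ζ, so P(y) dominates both
  -- integrands formed with g(ζ) and h(ζ).
  have hnear : ∀ ζ, θ ≤ ζ → ∀ y ∈ Ioo (ζ / θ) ζ, 1 < y ∧ ζ ∈ Ioo (y / θ) (θ * y) := by
    intro ζ hζ y hy
    have h1 : 1 ≤ ζ / θ := (one_le_div hθ0).2 hζ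
    have h2 : 1 < y := h1.trans_lt hy.1
    have h3 := (div_lt_iff₀ hθ0).1 hy.1
    exact ⟨h2, (div_lt_self (by linarith) hθ).trans hy.2, by linarith⟩
  have hJh : ∀ ζ, θ ≤ ζ → ζ ^ 2 ≤ κ * J ζ * h ζ := by
    intro ζ hζ
    have hpos := hh.pos ζ (hθ0.trans_le hζ)
    have := mul_sq_le_setIntegral_id_mul hP hP0 hθ hζ (w := 1 / h ζ) fun y hy => by
      obtain ⟨h1, h2⟩ := hnear ζ hζ y hy
      have h3 := one_div_le_one_div_of_le (hh.infNear_pos hθ (by linarith))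
        (hh.infNear_le hθ (by linarith) h2)
      exact h3.trans (le_add_of_nonneg_right (hP2 y h1))
    rw [one_div_mul_eq_div, div_le_iff₀ hpos] at this
    exact this
  have hJg : ∀ ζ, θ ≤ ζ → ζ ^ 3 ≤ κ ^ 2 * J ζ ^ 2 * g ζ := by
    intro ζ hζ
    have hζ0 : 0 < ζ := hθ0.trans_le hζ
    have hpos := hg.pos ζ hζ0
    have := mul_sq_le_setIntegral_id_mul hP hP0 hθ hζ (w := (g ζ * ζ) ^ (-(1 / 2) : ℝ))
      fun y hy => by
        obtain ⟨h1, h2⟩ := hnear ζ hζ y hy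
        have hpy := hg.infNear_pos hθ (by linarith : 0 < y)
        have h3 := Real.rpow_le_rpow_of_nonpos (mul_pos hpy (by linarith))
          (mul_le_mul (hg.infNear_le hθ (by linarith) h2) hy.2.le (by linarith) hpos.le)
          (by norm_num : (-(1 / 2) : ℝ) ≤ 0)
        exact h3.trans (le_add_of_nonneg_left (hP1 y h1))
    have hw0 : 0 ≤ (g ζ * ζ) ^ (-(1 / 2) : ℝ) := by positivity
    have hw2 : ((g ζ * ζ) ^ (-(1 / 2) : ℝ)) ^ 2 = (g ζ * ζ)⁻¹ := by
      rw [← Real.rpow_natCast, ← Real.rpow_mul (by positivity), ← Real.rpow_neg_one]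
      norm_num
    have h4 : ((g ζ * ζ) ^ (-(1 / 2) : ℝ) * ζ ^ 2) ^ 2 ≤ (κ * J ζ) ^ 2 :=
      pow_le_pow_left₀ (by positivity) this 2
    rw [mul_pow, hw2] at h4
    have h5 : (g ζ * ζ)⁻¹ * (ζ ^ 2) ^ 2 * g ζ = ζ ^ 3 := by field_simp
    rw [← h5, ← mul_pow]
    exact mul_le_mul_of_nonneg_right h4 hpos.le
  exact ⟨P, κ, hκ0, hP, hP0, hJh, hJg⟩

theorem exists_factor_slope_bounds {g h J : ℝ → ℝ} (hg : IsPositiveWeight g)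
    (hh : IsPositiveWeight h) {θ κ I : ℝ} (hθ : 1 < θ) (hκ0 : 0 < κ) (hI0 : 0 ≤ I)
    (hJ0 : ∀ z, 0 ≤ J z) (hJI : ∀ z, 0 ≤ z → J z ≤ z * I)
    (hJh : ∀ ζ, θ ≤ ζ → ζ ^ 2 ≤ κ * J ζ * h ζ) (hJg : ∀ ζ, θ ≤ ζ → ζ ^ 3 ≤ κ ^ 2 * J ζ ^ 2 * g ζ)
    {ε : ℝ} (hε : 0 < ε) :
    ∃ A, 1 ≤ A ∧ ∀ ζ, ε ≤ ζ → ζ ^ 2 ≤ A * (1 + J ζ) * h ζ ∧ 2 * ζ ^ 2 ≤ A * (1 + J ζ) * g ζ ∧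
      4 * ζ ^ 3 ≤ (A * (1 + J ζ)) ^ 2 * g ζ := by
  have hθ0 : 0 < θ := one_pos.trans hθ
  have hcomp : Icc ε θ ⊆ Ioi 0 := fun z hz => hε.trans_le hz.1
  obtain ⟨cg, hcg, hcg'⟩ := hg.inf_pos _ isCompact_Icc hcomp
  obtain ⟨ch, hch, hch'⟩ := hh.inf_pos _ isCompact_Icc hcomp
  -- The terms with `ch` and `cg` serve ζ in [ε, θ]; those with κ serve ζ ≥ θ.
  set A : ℝ := 1 + θ ^ 2 / ch + 4 * θ ^ 3 / cg + 2 * θ ^ 2 / cg + 2 * κ + 2 * κ ^ 2 * I with hA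
  have a1 : 0 ≤ θ ^ 2 / ch := by positivity
  have a2 : 0 ≤ 4 * θ ^ 3 / cg := by positivity
  have a3 : 0 ≤ 2 * θ ^ 2 / cg := by positivity
  have a4 : 0 ≤ 2 * κ ^ 2 * I := by positivity
  have hA1 : 1 ≤ A := by linarith
  refine ⟨A, hA1, fun ζ hζ => ?_⟩
  have hζ0 : 0 < ζ := hε.trans_le hζ
  have hgp := hg.pos ζ hζ0
  have hhp := hh.pos ζ hζ0
  have hJz := hJ0 ζ
  have hAJ : A ≤ A * (1 + J ζ) := le_mul_of_one_le_right (by linarith) (by linarith)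
  rcases le_total ζ θ with hle | hle
  · have h1 := hcg' ζ ⟨hζ, hle⟩
    have h2 := hch' ζ ⟨hζ, hle⟩
    have p2 : ζ ^ 2 ≤ θ ^ 2 := by gcongr
    have p3 : ζ ^ 3 ≤ θ ^ 3 := by gcongr
    refine ⟨?_, ?_, ?_⟩
    · calc ζ ^ 2 ≤ θ ^ 2 / ch * ch := by rw [div_mul_cancel₀ _ hch.ne']; exact p2
        _ ≤ A * (1 + J ζ) * h ζ := by gcongr; linarith
    · calc 2 * ζ ^ 2 ≤ 2 * θ ^ 2 / cg * cg := by rw [div_mul_cancel₀ _ hcg.ne']; linarith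
        _ ≤ A * (1 + J ζ) * g ζ := by gcongr; linarith
    · calc 4 * ζ ^ 3 ≤ 4 * θ ^ 3 / cg * cg := by rw [div_mul_cancel₀ _ hcg.ne']; linarith
        _ ≤ (A * (1 + J ζ)) ^ 2 * g ζ := by
          gcongr
          have : A * (1 + J ζ) ≤ (A * (1 + J ζ)) ^ 2 := by nlinarith
          linarith
  · have h1 := hJh ζ hle
    have h2 := hJg ζ hle
    have h3 : J ζ ≤ ζ * I := hJI ζ hζ0.le
    refine ⟨?_, ?_, ?_⟩
    · refine h1.trans ?_
      gcongr <;> linarith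
    -- One factor J ≤ ζI turns the bound quadratic in J into a linear one, at the cost of a power of
    -- ζ.
    · have h4 : ζ * ζ ^ 2 ≤ ζ * (κ ^ 2 * I * J ζ * g ζ) := by
        calc ζ * ζ ^ 2 = ζ ^ 3 := by ring
          _ ≤ κ ^ 2 * J ζ ^ 2 * g ζ := h2
          _ = κ ^ 2 * (J ζ * J ζ) * g ζ := by ring
          _ ≤ κ ^ 2 * (J ζ * (ζ * I)) * g ζ := by gcongr
          _ = _ := by ring
      have h5 := le_of_mul_le_mul_left h4 hζ0
      calc 2 * ζ ^ 2 ≤ 2 * κ ^ 2 * I * J ζ * g ζ := by linarith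
        _ ≤ A * (1 + J ζ) * g ζ := by gcongr <;> linarith
    · calc 4 * ζ ^ 3 ≤ (2 * κ * J ζ) ^ 2 * g ζ := by
            have : (2 * κ * J ζ) ^ 2 * g ζ = 4 * (κ ^ 2 * J ζ ^ 2 * g ζ) := by ring
            linarith
        _ ≤ (A * (1 + J ζ)) ^ 2 * g ζ := by gcongr <;> linarith

/-- A concave function `Γ` of `1 / (ζ - ε)` with slopes `N` controlled by `g` and `h`. -/
theorem exists_value_barrier {g h : ℝ → ℝ} (hg : IsPositiveWeight g) (hh : IsPositiveWeight h)
    {θ : ℝ} (hθ : 1 < θ)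
    (hgθ : ∫⁻ ζ in Ioi (1 : ℝ), ENNReal.ofReal ((infNear θ g ζ * ζ) ^ (-(1 / 2) : ℝ)) < ⊤)
    (hhθ : ∫⁻ ζ in Ioi (1 : ℝ), ENNReal.ofReal (1 / infNear θ h ζ) < ⊤)
    {ε : ℝ} (hε : 0 < ε) (hε' : ε ≤ 1 / 2) :
    ∃ Γ N : ℝ → ℝ, ContinuousOn Γ (Ioi 0) ∧ (∀ τ, 0 < τ → 0 < Γ τ) ∧
      (∀ τ σ, 0 < τ → 0 < σ → Γ σ ≤ Γ τ + N τ * (σ - τ)) ∧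
      ∀ τ, 0 < τ → 1 ≤ N τ ∧ (1 / τ) ^ 2 ≤ N τ * h (1 / τ + ε) ∧
        2 * (1 / τ) ^ 2 ≤ N τ * g (1 / τ + ε) ∧ 4 * (1 / τ) ^ 3 ≤ N τ ^ 2 * g (1 / τ + ε) := by
  obtain ⟨P, κ, hκ0, hP, hP0, hJh, hJg⟩ := exists_integrable_majorant hg hh hθ hgθ hhθ
  set J : ℝ → ℝ := fun z => ∫ y in Ioc 1 z, y * P y with hJ
  have hJ0 : ∀ z, 0 ≤ J z := setIntegral_id_mul_nonneg hP0
  have hJm : Monotone J := setIntegral_id_mul_mono hP hP0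
  obtain ⟨A, hA1, key⟩ := exists_factor_slope_bounds hg hh hθ hκ0
    (setIntegral_nonneg measurableSet_Ioi hP0) hJ0
    (fun z hz => setIntegral_id_mul_le hP hP0 hz) hJh hJg hε
  set N : ℝ → ℝ := fun τ => A * (1 + J (1 / τ + ε)) with hN
  have hN1 : ∀ τ, 0 < τ → 1 ≤ N τ := fun τ _ => by
    have := hJ0 (1 / τ + ε)
    simp only [hN]
    nlinarith
  have hanti : AntitoneOn N (Ioi 0) := by
    intro a ha b hb hab
    have : 1 / b ≤ 1 / a := one_div_le_one_div_of_le ha hab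
    have h2 : J (1 / b + ε) ≤ J (1 / a + ε) := hJm (by linarith)
    simp only [hN]
    gcongr
  have hint : IntegrableOn N (Ioc 0 1) := by
    have h1 : IntegrableOn (fun _ : ℝ => (1 : ℝ)) (Ioc 0 1) := by simp
    exact (h1.add (integrableOn_setIntegral_id_mul hP hP0 hε hε')).const_mul A
  obtain ⟨Γ, hc, hpos, hslope⟩ := exists_concave_primitive hanti hN1 hint
  refine ⟨Γ, N, hc, hpos, hslope, fun τ hτ => ⟨hN1 τ hτ, ?_⟩⟩
  have hs0 : 0 < 1 / τ := by positivity
  obtain ⟨k1, k2, k3⟩ := key (1 / τ + ε) (by linarith)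
  have p2 : (1 / τ) ^ 2 ≤ (1 / τ + ε) ^ 2 := by gcongr; linarith
  have p3 : (1 / τ) ^ 3 ≤ (1 / τ + ε) ^ 3 := by gcongr; linarith
  exact ⟨p2.trans k1, by linarith, by linarith⟩

/-! ### Comparison with the barrier. -/

theorem continuousAt_uncurry {n : ℕ} {u : Rn n → ℝ → ℝ} (hu : IsC21 u) (z : Rn n × ℝ)
    (hz : 0 < z.2) : ContinuousAt (fun z : Rn n × ℝ => u z.1 z.2) z :=
  hu.continuousOn.continuousAt ((isOpen_univ.prod isOpen_Ioi).mem_nhds ⟨mem_univ _, hz⟩)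

/-- At a point of contact with the barrier the equation is violated. -/
theorem not_contact {n : ℕ} {a : Rn n → ℝ → Matrix (Fin n) (Fin n) ℝ} {f : Rn n → ℝ → Rn n → ℝ}
    {p : Rn n → ℝ} {g h : ℝ → ℝ} (ha : IsPositiveAwayFromZero a) (hf : StructuralBound a f p g h)
    {u : Rn n → ℝ → ℝ} (hu : IsClassicalSolution a f u)
    {x : Rn n} {t ε v m N c : ℝ} (ht : 0 < t) (hε : 0 < ε) (hv : 0 < v) (hm : 0 < m)
    (hmp : m ≤ p x) (hmx : m * ‖x‖ ^ 2 ≤ 1) (hN : 1 ≤ N)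
    (hNh : (1 / v) ^ 2 ≤ N * h (1 / v + ε)) (hNg : 2 * (1 / v) ^ 2 ≤ N * g (1 / v + ε))
    (hNg2 : 4 * (1 / v) ^ 3 ≤ N ^ 2 * g (1 / v + ε)) (hcp : c ≤ p x)
    (hut : u x t = ε + 1 / v)
    (hspace : ∀ᶠ y in 𝓝 x, u y t ≤ ε + 1 / (v - m / (2 * N) * (‖y‖ ^ 2 - ‖x‖ ^ 2)))
    (htime : ∀ᶠ τ in 𝓝[<] t, u x τ ≤ ε + 1 / (v + c / N * (τ - t))) : False := by
  have hN0 : 0 < N := one_pos.trans_le hN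
  have hU := hu.regular.contDiff_x t ht
  have hk : 0 ≤ m / (2 * N) := by positivity
  have hζ : u x t = 1 / v + ε := by rw [hut, add_comm]
  have hs : 0 < 1 / v := by positivity
  set s := 1 / v with hsdef
  have hζ0 : 0 < u x t := by rw [hζ]; positivity
  set A := ∑ i, ∑ j, |a x (u x t) i j| with hA
  have hA0 : 0 ≤ A := Finset.sum_nonneg fun i _ => Finset.sum_nonneg fun j _ => abs_nonneg _
  have hgrad := contact_gradient hU hv hut hspace
  have hlam : 2 * (m / (2 * N)) / v ^ 2 = m * s ^ 2 / N := by
    rw [hsdef]; field_simp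
  rw [hlam] at hgrad
  have hp0 : 0 < p x := hm.trans_le hmp
  rw [← hζ] at hNh hNg hNg2
  have hh0 : 0 < h (u x t) := pos_of_mul_pos_right ((by positivity : 0 < s ^ 2).trans_le hNh) hN0.le
  have hg0 : 0 < g (u x t) :=
    pos_of_mul_pos_right ((by positivity : 0 < 2 * s ^ 2).trans_le hNg) hN0.le
  have hflow := hf x (u x t) (m * s ^ 2 / N) hζ0.ne'
    (by rw [Real.sign_of_pos hζ0, mul_one]; positivity)
    (by
      rw [Real.sign_of_pos hζ0, mul_one, abs_of_pos hζ0, div_le_iff₀ hN0]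
      calc m * s ^ 2 ≤ p x * (N * h (u x t)) := by gcongr
        _ = _ := by ring)
  rw [Real.sign_of_pos hζ0, mul_one, abs_of_pos hζ0, ← hgrad] at hflow
  have hhess := contact_hessian hU hv hk hut hspace (A := a x (u x t)) fun ξ => by
    by_cases h0 : ξ = 0
    · simp [h0]
    · exact (ha x (u x t) (WithLp.toLp 2 ξ) hζ0.ne'
        fun h1 => h0 (by simpa using congrArg WithLp.ofLp h1)).le
  -- Each summand is at most m g/2: the first by m‖x‖² ≤ 1 and `hNg2`, the second by `hNg`.
  have hcoef : 8 * (m / (2 * N)) ^ 2 * ‖x‖ ^ 2 / v ^ 3 + 2 * (m / (2 * N)) / v ^ 2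
      ≤ p x * g (u x t) := by
    have e : 8 * (m / (2 * N)) ^ 2 * ‖x‖ ^ 2 / v ^ 3
        = m * (m * ‖x‖ ^ 2) * (2 * s ^ 3 / N ^ 2) := by
      rw [hsdef]; field_simp; ring
    have b1 : 2 * s ^ 3 / N ^ 2 ≤ g (u x t) / 2 := by
      rw [div_le_iff₀ (by positivity)]; linarith
    have b2 : s ^ 2 / N ≤ g (u x t) / 2 := by
      rw [div_le_iff₀ hN0]; linarith
    rw [e, hlam]
    calc m * (m * ‖x‖ ^ 2) * (2 * s ^ 3 / N ^ 2) + m * s ^ 2 / N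
        = m * (m * ‖x‖ ^ 2) * (2 * s ^ 3 / N ^ 2) + m * (s ^ 2 / N) := by ring
      _ ≤ m * 1 * (g (u x t) / 2) + m * (g (u x t) / 2) := by gcongr
      _ = m * g (u x t) := by ring
      _ ≤ p x * g (u x t) := by gcongr
  have htd : 0 ≤ deriv (u x) t + c / N * s ^ 2 := by
    have h1 : HasDerivAt (fun τ => v + c / N * (τ - t)) (c / N) t := by
      simpa using (((hasDerivAt_id t).sub_const t).const_mul (c / N)).const_add v
    have h2 := (hu.regular.differentiable_t x t ht).hasDerivAt.sub
      (h1.fun_inv (by simpa using hv.ne'))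
    refine (deriv_nonneg_of_left_le h2 ?_).trans_eq ?_
    · filter_upwards [htime] with τ hτ
      simp only [Pi.sub_apply, sub_self, mul_zero, add_zero, hut, hsdef]
      simp only [one_div] at hτ ⊢
      linarith
    · rw [sub_self, mul_zero, add_zero, hsdef]
      ring
  -- With A = ∑|a_ij|, the left side is at least -pg/2 - pgA + pg(1 + A) = pg/2 > 0.
  have heq := hu.equation x t ht
  have h1 := hhess.trans (mul_le_mul_of_nonneg_right hcoef hA0)
  have h2 : c / N * s ^ 2 ≤ p x * g (u x t) / 2 := by
    have : c / N * s ^ 2 = c * s ^ 2 / N := by ring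
    rw [this, div_le_iff₀ hN0]
    calc c * s ^ 2 ≤ p x * (N * g (u x t) / 2) := by gcongr; linarith
      _ = _ := by ring
  have h3 : 0 < p x * g (u x t) := by positivity
  have h4 : p x * g (u x t) * (1 + A) = p x * g (u x t) + p x * g (u x t) * A := by ring
  rw [h4] at hflow
  linarith

theorem sub_le_one_div_of_le {ζ ε w : ℝ} (hζ : ε < ζ) (hw : 0 < w) (h : w ≤ 1 / (ζ - ε)) :
    ζ ≤ ε + 1 / w := by
  have := (le_one_div hw (sub_pos.2 hζ)).1 h
  linarith

/-- Comparison with the barrier that is infinite at time `t₀`. -/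
theorem barrier_pos {n : ℕ} {a : Rn n → ℝ → Matrix (Fin n) (Fin n) ℝ} {f : Rn n → ℝ → Rn n → ℝ}
    {p : Rn n → ℝ} {g h : ℝ → ℝ} (ha : IsPositiveAwayFromZero a) (hf : StructuralBound a f p g h)
    {u : Rn n → ℝ → ℝ} (hu : IsClassicalSolution a f u)
    {Φ m : Rn n → ℝ} (hΦc : Continuous Φ) (hΦ0 : ∀ x, 0 ≤ Φ x) (hm : ∀ x, 0 < m x)
    (hmp : ∀ x, m x ≤ p x) (hmx : ∀ x, m x * ‖x‖ ^ 2 ≤ 1)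
    (hΦ : ∀ x y, Φ y ≤ Φ x + m x / 2 * (‖y‖ ^ 2 - ‖x‖ ^ 2))
    {Γ N : ℝ → ℝ} {ε : ℝ} (hε : 0 < ε) (hΓc : ContinuousOn Γ (Ioi 0)) (hΓ0 : ∀ τ, 0 < τ → 0 < Γ τ)
    (hΓ : ∀ τ σ, 0 < τ → 0 < σ → Γ σ ≤ Γ τ + N τ * (σ - τ))
    (hN : ∀ τ, 0 < τ → 1 ≤ N τ ∧ (1 / τ) ^ 2 ≤ N τ * h (1 / τ + ε) ∧
        2 * (1 / τ) ^ 2 ≤ N τ * g (1 / τ + ε) ∧ 4 * (1 / τ) ^ 3 ≤ N τ ^ 2 * g (1 / τ + ε))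
    {D R c : ℝ} (hc : 0 < c) (hR : ∀ x, Φ x ≤ D → ‖x‖ ≤ R ∧ c ≤ p x)
    {t₀ : ℝ} (ht₀ : 0 < t₀) (x : Rn n) {t : ℝ} (ht : t ∈ Icc t₀ (t₀ + D / c)) (hut : ε < u x t) :
    0 < Γ (1 / (u x t - ε)) + Φ x - c * (t - t₀) := by
  set F : Rn n × ℝ → ℝ := fun z => Γ (1 / (u z.1 z.2 - ε)) + Φ z.1 - c * (z.2 - t₀) with hF
  by_contra! hneg
  set B : Set (Rn n × ℝ) := {z | z.2 ∈ Icc t₀ (t₀ + D / c) ∧ ε < u z.1 z.2 ∧ F z ≤ 0} with hB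
  have hD0 : 0 ≤ D := by
    have := ht.1.trans ht.2
    have h1 : 0 ≤ D / c := by linarith
    have := mul_nonneg h1 hc.le
    rwa [div_mul_cancel₀ _ hc.ne'] at this
  have hFc : ∀ z : Rn n × ℝ, 0 < z.2 → ε < u z.1 z.2 → ContinuousAt F z := by
    intro z hz huz
    have h1 : ContinuousAt (fun z : Rn n × ℝ => 1 / (u z.1 z.2 - ε)) z :=
      continuousAt_const.div ((continuousAt_uncurry hu.regular z hz).sub continuousAt_const)
        (by linarith [huz])
    have h2 : ContinuousAt Γ (1 / (u z.1 z.2 - ε)) :=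
      hΓc.continuousAt (Ioi_mem_nhds (one_div_pos.2 (by linarith)))
    have h3 : ContinuousAt (fun z : Rn n × ℝ => Γ (1 / (u z.1 z.2 - ε))) z :=
      ContinuousAt.comp (f := fun z : Rn n × ℝ => 1 / (u z.1 z.2 - ε)) h2 h1
    have h4 : Continuous fun z : Rn n × ℝ => Φ z.1 := hΦc.comp continuous_fst
    have h5 : Continuous fun z : Rn n × ℝ => c * (z.2 - t₀) := by fun_prop
    exact (h3.add h4.continuousAt).sub h5.continuousAt
  set C : Set (Rn n × ℝ) := Metric.closedBall 0 R ×ˢ Icc t₀ (t₀ + D / c) with hCdef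
  have hCpos : ∀ z ∈ C, 0 < z.2 := fun z hz => ht₀.trans_le hz.2.1
  have hCc : IsCompact C := (isCompact_closedBall _ _).prod isCompact_Icc
  have huC : ContinuousOn (fun z : Rn n × ℝ => u z.1 z.2) C := fun z hz =>
    (continuousAt_uncurry hu.regular z (hCpos z hz)).continuousWithinAt
  set C' : Set (Rn n × ℝ) :=
    C ∩ (fun z : Rn n × ℝ => u z.1 z.2) ⁻¹' Ici (ε + 1 / (D + 1)) with hC'
  have hC'c : IsCompact C' := hCc.of_isClosed_subset
    (huC.preimage_isClosed_of_isClosed hCc.isClosed isClosed_Ici) inter_subset_left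
  have hε' : ∀ z ∈ C', ε < u z.1 z.2 := fun z hz => by
    have h1 : ε + 1 / (D + 1) ≤ u z.1 z.2 := hz.2
    have : 0 < 1 / (D + 1) := by positivity
    linarith
  -- F ≤ 0 forces Φ ≤ D, which bounds x, and Γ ≤ D, which keeps u away from ε; thus B is compact and
  -- has an earliest point.
  have hBC : B = C' ∩ F ⁻¹' Iic 0 := by
    ext z
    constructor
    · rintro ⟨hzt, hzu, hzF⟩
      have hv0 : 0 < 1 / (u z.1 z.2 - ε) := one_div_pos.2 (sub_pos.2 hzu)
      have htime : c * (z.2 - t₀) ≤ D := by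
        calc c * (z.2 - t₀) ≤ c * (D / c) := by gcongr; linarith [hzt.2]
          _ = D := by field_simp
      have hFz : Γ (1 / (u z.1 z.2 - ε)) + Φ z.1 - c * (z.2 - t₀) ≤ 0 := hzF
      have hG := hΓ0 _ hv0
      have hΦz := hΦ0 z.1
      have hzR := (hR z.1 (by linarith)).1
      refine ⟨⟨⟨by simpa using hzR, hzt⟩, ?_⟩, hzF⟩
      -- As the slopes of Γ are at least 1 and Γ(1) > 0, an argument v > D + 1 would give Γ(v) > v -
      -- 1 > D.
      have hv : 1 / (u z.1 z.2 - ε) ≤ D + 1 := by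
        by_contra! hlt
        have h1 := hΓ _ 1 hv0 one_pos
        have h2 := hΓ0 1 one_pos
        have h3 := (hN _ hv0).1
        nlinarith
      have := (one_div_le (sub_pos.2 hzu) (by linarith)).1 hv
      change ε + 1 / (D + 1) ≤ u z.1 z.2
      linarith
    · rintro ⟨hz, hzF⟩
      exact ⟨hz.1.2, hε' z hz, hzF⟩
  have hBc : IsCompact B := by
    have hFC : ContinuousOn F C' := fun z hz =>
      (hFc z (hCpos z hz.1) (hε' z hz)).continuousWithinAt
    rw [hBC]
    exact hC'c.of_isClosed_subset (hFC.preimage_isClosed_of_isClosed hC'c.isClosed isClosed_Iic)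
      inter_subset_left
  obtain ⟨⟨x₁, t₁⟩, hz₁, hmin⟩ := hBc.exists_isMinOn ⟨(x, t), ht, hut, hneg⟩
    (f := fun z : Rn n × ℝ => z.2) continuous_snd.continuousOn
  obtain ⟨ht₁, hu₁, hF₁⟩ := hz₁
  dsimp only at ht₁ hu₁
  have hv₁ : 0 < 1 / (u x₁ t₁ - ε) := one_div_pos.2 (sub_pos.2 hu₁)
  have hbefore : ∀ (y : Rn n) (τ : ℝ), τ ∈ Ico t₀ t₁ → ε < u y τ → 0 < F (y, τ) := by
    intro y τ hτ hy
    by_contra! hle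
    have h1 : t₁ ≤ τ := hmin (show (y, τ) ∈ B from ⟨⟨hτ.1, hτ.2.le.trans ht₁.2⟩, hy, hle⟩)
    exact absurd hτ.2 (not_lt.2 h1)
  have ht₀₁ : t₀ < t₁ := by
    refine lt_of_le_of_ne ht₁.1 fun h => ?_
    have h1 : Γ (1 / (u x₁ t₁ - ε)) + Φ x₁ - c * (t₁ - t₀) ≤ 0 := hF₁
    have h2 := hΓ0 _ hv₁
    have h3 := hΦ0 x₁
    rw [h, sub_self, mul_zero] at h1
    linarith
  have hpos₁ : 0 < t₁ := ht₀.trans ht₀₁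
  have hIco : ∀ᶠ τ in 𝓝[<] t₁, τ ∈ Ico t₀ t₁ := by
    filter_upwards [Ioo_mem_nhdsLT ht₀₁] with τ hτ using ⟨hτ.1.le, hτ.2⟩
  -- If u > ε at (y, t₁), the same holds shortly before, where F > 0; pass to the limit.
  have hat : ∀ y, ε < u y t₁ → 0 ≤ F (y, t₁) := by
    intro y hy
    have hline : Tendsto (fun τ => (y, τ)) (𝓝[<] t₁) (𝓝 (y, t₁)) :=
      ((by fun_prop : Continuous fun τ : ℝ => (y, τ)).tendsto t₁).mono_left nhdsWithin_le_nhds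
    have e1 := (((continuousAt_uncurry hu.regular (y, t₁) hpos₁).tendsto.comp hline).eventually
      (lt_mem_nhds hy))
    refine ge_of_tendsto ((hFc (y, t₁) hpos₁ hy).tendsto.comp hline) ?_
    filter_upwards [e1, hIco] with τ h1 h2
    exact (hbefore y τ h2 h1).le
  have hF₁0 : F (x₁, t₁) = 0 := le_antisymm hF₁ (hat x₁ hu₁)
  simp only [hF] at hF₁0 hbefore hat
  set v := 1 / (u x₁ t₁ - ε) with hv
  obtain ⟨n1, n2, n3, n4⟩ := hN v hv₁
  have hN0 : 0 < N v := one_pos.trans_le n1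
  have htime₁ : c * (t₁ - t₀) ≤ D := by
    calc c * (t₁ - t₀) ≤ c * (D / c) := by gcongr; linarith [ht₁.2]
      _ = D := by field_simp
  have hcp : c ≤ p x₁ := (hR x₁ (by linarith [hΓ0 v hv₁])).2
  refine not_contact ha hf hu hpos₁ hε hv₁ (hm x₁) (hmp x₁) (hmx x₁) n1 n2 n3 n4 hcp
    (by rw [hv, one_div_one_div]; ring) ?_ ?_
  · have hcont : Continuous fun y : Rn n => v - m x₁ / (2 * N v) * (‖y‖ ^ 2 - ‖x₁‖ ^ 2) := by
      fun_prop
    filter_upwards [(hcont.tendsto x₁).eventually_const_lt (u := 0) (by simpa using hv₁)] with y hy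
    rcases le_or_gt (u y t₁) ε with hle | hlt
    · exact hle.trans (le_add_of_nonneg_right (one_div_pos.2 hy).le)
    · refine sub_le_one_div_of_le hlt hy ?_
      -- Adding both supporting-line inequalities to F(y, t₁) ≥ 0 = F(x₁, t₁) gives a lower bound on
      -- 1/(u - ε), that is, contact from above.
      have h1 := hΓ v _ hv₁ (one_div_pos.2 (sub_pos.2 hlt))
      have h2 := hΦ x₁ y
      have h3 := hat y hlt
      have h4 : 0 ≤ N v * (1 / (u y t₁ - ε) - v) + m x₁ / 2 * (‖y‖ ^ 2 - ‖x₁‖ ^ 2) := by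
        linarith
      have h5 : N v * (v - m x₁ / (2 * N v) * (‖y‖ ^ 2 - ‖x₁‖ ^ 2))
          = N v * v - m x₁ / 2 * (‖y‖ ^ 2 - ‖x₁‖ ^ 2) := by field_simp
      refine le_of_mul_le_mul_left ?_ hN0
      rw [h5]
      linarith
  · have hcont : Continuous fun τ : ℝ => v + c / N v * (τ - t₁) := by fun_prop
    filter_upwards [((hcont.tendsto t₁).eventually_const_lt (u := 0)
      (by simpa using hv₁)).filter_mono nhdsWithin_le_nhds, hIco] with τ hy hτ
    rcases le_or_gt (u x₁ τ) ε with hle | hlt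
    · exact hle.trans (le_add_of_nonneg_right (one_div_pos.2 hy).le)
    · refine sub_le_one_div_of_le hlt hy ?_
      have h1 := hΓ v _ hv₁ (one_div_pos.2 (sub_pos.2 hlt))
      have h3 := hbefore x₁ τ hτ hlt
      have h5 : N v * (v + c / N v * (τ - t₁)) = N v * v + c * (τ - t₁) := by field_simp
      refine le_of_mul_le_mul_left ?_ hN0
      rw [h5]
      linarith

theorem eventually_le_of_solution {n : ℕ} {a : Rn n → ℝ → Matrix (Fin n) (Fin n) ℝ}
    {f : Rn n → ℝ → Rn n → ℝ} {p : Rn n → ℝ} {g h : ℝ → ℝ} (ha : IsPositiveAwayFromZero a)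
    (hp : ∀ x, 0 ≤ p x) (hg : IsPositiveWeight g) (hh : IsPositiveWeight h)
    (hf : StructuralBound a f p g h)
    (hq : ∫⁻ r in Ioi (1 : ℝ), ENNReal.ofReal (r * ballInf p r) = ⊤)
    {θ : ℝ} (hθ : 1 < θ)
    (hgθ : ∫⁻ ζ in Ioi (1 : ℝ), ENNReal.ofReal ((infNear θ g ζ * ζ) ^ (-(1 / 2) : ℝ)) < ⊤)
    (hhθ : ∫⁻ ζ in Ioi (1 : ℝ), ENNReal.ofReal (1 / infNear θ h ζ) < ⊤)
    {u : Rn n → ℝ → ℝ} (hu : IsClassicalSolution a f u)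
    {K : Set (Rn n)} (hK : IsCompact K) {η : ℝ} (hη : 0 < η) :
    ∀ᶠ t in atTop, ∀ x ∈ K, u x t ≤ η := by
  -- The bound 1/2 is required by the value barrier; η/2 gives 2ε ≤ η.
  set ε := min (η / 2) (1 / 2) with hεdef
  have hε : 0 < ε := by positivity
  have hεη : 2 * ε ≤ η := by linarith [min_le_left (η / 2) (1 / 2)]
  obtain ⟨Φ, m, hΦc, hΦ0, hm, hmp, hmx, hΦ, hΦD⟩ := exists_space_barrier hp hq
  obtain ⟨Γ, N, hΓc, hΓ0, hΓ, hN⟩ := exists_value_barrier hg hh hθ hgθ hhθ hε (min_le_right _ _)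
  obtain ⟨M, hM⟩ := (hK.image hΦc).bddAbove
  set D := Γ (1 / ε) + max M 0 with hD
  have hD0 : 0 < D := add_pos_of_pos_of_nonneg (hΓ0 _ (by positivity)) (le_max_right _ _)
  obtain ⟨R, c, hc, hR⟩ := hΦD D
  filter_upwards [eventually_gt_atTop (D / c)] with t ht x hx
  by_contra! hlt
  have hlt' : ε < u x t := by linarith
  have hDc : 0 ≤ D / c := by positivity
  -- Starting the barrier at t - D/c gives Γ(1/(u - ε)) > D - Φ ≥ Γ(1/ε) at time t, which u > 2ε
  -- contradicts.
  have h1 := barrier_pos ha hf hu hΦc hΦ0 hm hmp hmx hΦ hε hΓc hΓ0 hΓ hN hc hR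
    (t₀ := t - D / c) (sub_pos.2 ht) x (t := t) ⟨by linarith, by linarith⟩ hlt'
  have h2 : c * (t - (t - D / c)) = D := by field_simp; ring
  rw [h2] at h1
  have h3 : Φ x ≤ max M 0 := (hM ⟨x, hx, rfl⟩).trans (le_max_left _ _)
  have h4 : 1 / (u x t - ε) ≤ 1 / ε := one_div_le_one_div_of_le hε (by linarith)
  have hε0 : 0 < 1 / ε := by positivity
  have h5 := hΓ _ _ hε0 (one_div_pos.2 (sub_pos.2 hlt'))
  have h6 := (hN _ hε0).1
  have h7 : N (1 / ε) * (1 / (u x t - ε) - 1 / ε) ≤ 0 :=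
    mul_nonpos_of_nonneg_of_nonpos (by linarith) (by linarith)
  linarith

/-! ### Reflection u ↦ -u and the conclusion. -/

theorem pderivX_neg {n : ℕ} (i : Fin n) (v : Rn n → ℝ) :
    pderivX i (fun y => -v y) = fun y => -pderivX i v y := by
  funext x
  simp only [pderivX]
  rw [fderiv_fun_neg]
  rfl

theorem IsClassicalSolution.neg {n : ℕ} {a : Rn n → ℝ → Matrix (Fin n) (Fin n) ℝ}
    {f : Rn n → ℝ → Rn n → ℝ} {u : Rn n → ℝ → ℝ} (hu : IsClassicalSolution a f u) :
    IsClassicalSolution (fun x ζ => a x (-ζ)) (fun x ζ ξ => -f x (-ζ) (-ξ))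
      (fun x t => -u x t) where
  regular :=
    { contDiff_x := fun t ht => (hu.regular.contDiff_x t ht).neg
      differentiable_t := fun x t ht => (hu.regular.differentiable_t x t ht).fun_neg
      continuousOn := hu.regular.continuousOn.neg
      continuousOn_x := fun i => by
        simp only [pderivX_neg]
        exact (hu.regular.continuousOn_x i).neg
      continuousOn_xx := fun i j => by
        simp only [pderivX_neg]
        exact (hu.regular.continuousOn_xx i j).neg
      continuousOn_t := by
        simp only [deriv.fun_neg]
        exact hu.regular.continuousOn_t.neg }
  equation := fun x t ht => by
    have h := hu.equation x t ht
    have hgrad : gradient (fun y => -u y t) x = -gradient (fun y => u y t) x := by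
      rw [gradient, gradient, fderiv_fun_neg, map_neg]
    simp only [pderivX_neg, neg_neg, hgrad, deriv.fun_neg, mul_neg, Finset.sum_neg_distrib]
    linarith

theorem StructuralBound.neg {n : ℕ} {a : Rn n → ℝ → Matrix (Fin n) (Fin n) ℝ}
    {f : Rn n → ℝ → Rn n → ℝ} {p : Rn n → ℝ} {g h : ℝ → ℝ} (hf : StructuralBound a f p g h) :
    StructuralBound (fun x ζ => a x (-ζ)) (fun x ζ ξ => -f x (-ζ) (-ξ)) p g h := by
  intro x ζ lam hζ h0 h1
  have h := hf x (-ζ) (-lam) (neg_ne_zero.2 hζ)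
  simp only [Real.sign_neg, abs_neg, neg_smul, mul_neg] at h
  simp only [neg_mul, neg_neg] at h ⊢
  exact h h0 h1

theorem theorem2p1 (n : ℕ) (hn : 1 ≤ n)
    (a : Rn n → ℝ → Matrix (Fin n) (Fin n) ℝ) (f : Rn n → ℝ → Rn n → ℝ)
    (p : Rn n → ℝ) (g h : ℝ → ℝ)
    (ha : IsPositiveAwayFromZero a)
    (hp : IsNonnegWeight p) (hg : IsPositiveWeight g) (hh : IsPositiveWeight h)
    (hf : StructuralBound a f p g h)
    (hq : ∫⁻ r in Ioi (1 : ℝ), ENNReal.ofReal (r * ballInf p r) = ⊤)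
    (θ : ℝ) (hθ : 1 < θ)
    (hgθ : ∫⁻ ζ in Ioi (1 : ℝ), ENNReal.ofReal ((infNear θ g ζ * ζ) ^ (-(1 / 2) : ℝ)) < ⊤)
    (hhθ : ∫⁻ ζ in Ioi (1 : ℝ), ENNReal.ofReal (1 / infNear θ h ζ) < ⊤)
    (u : Rn n → ℝ → ℝ) (hu : IsClassicalSolution a f u)
    (K : Set (Rn n)) (hK : IsCompact K) :
    Tendsto (fun t : ℝ => sSup ((fun x => |u x t|) '' K)) atTop (𝓝 0) := by
  have ha' : IsPositiveAwayFromZero fun x ζ => a x (-ζ) := fun x ζ ξ hζ hξ =>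
    ha x (-ζ) ξ (neg_ne_zero.2 hζ) hξ
  rw [Metric.tendsto_nhds]
  intro e he
  filter_upwards [eventually_le_of_solution ha hp.nonneg hg hh hf hq hθ hgθ hhθ hu hK (half_pos he),
    eventually_le_of_solution ha' hp.nonneg hg hh hf.neg hq hθ hgθ hhθ hu.neg hK (half_pos he)]
    with t h1 h2
  have h3 : sSup ((fun x => |u x t|) '' K) ≤ e / 2 := by
    -- Nonnegativity of the bound covers empty K, where `sSup` is 0.
    refine Real.sSup_le ?_ (half_pos he).le
    rintro _ ⟨x, hx, rfl⟩
    exact abs_le'.2 ⟨h1 x hx, h2 x hx⟩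
  have h4 : 0 ≤ sSup ((fun x => |u x t|) '' K) :=
    Real.sSup_nonneg (by rintro _ ⟨x, -, rfl⟩; exact abs_nonneg _)
  rw [Real.dist_eq, sub_zero, abs_of_nonneg h4]
  linarith
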